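/- A player-specific congestion game consists of a finite set $N$ of players, a finite set $E$ of resources, for every player $i\in N$ a finite set $\Sigma_i\subseteq 2^E$ of strategies, and for every resource $e$ and player $i$ a delay function $d_{e,i}:\mathbb N\to\mathbb Z$. In a strategy profile $S=(s_i)_{i\in N}\in\prod_i\Sigma_i$, the congestion of $e$ is $n_e(S)=|\{i\in N: e\in s_i\}|$, the cost of player $i$ is $c_i(S)=\sum_{e\in s_i}d_{e,i}(n_e(S))$, and the utility of $i$ is $u_i(S)=-c_i(S)$. The state graph has the strategy profiles as vertices, and an arc from $S$ to $S'$ whenever $S'$ is obtained from $S$ by changing the strategy of a single player $i$ and $u_i(S')>u_i(S)$. A sink equilibrium is a strongly connected component of the state graph without outgoing arcs. The problem In a Sink for player-specific congestion games is: given a player-specific congestion game with players $1,\dots,n$, described explicitly (the strategies of every player are listed, each as a set of resources, and the values $d_{e,i}(k)$, $1\le k\le n$, are listed as integers in binary), together with a strategy profile $S$ of this game, decide whether $S$ belongs to a sink equilibrium. Theorem. In a Sink for player-specific congestion games is PSPACE-hard: every language $L\subseteq\{0,1\}^*$ that is decided by a deterministic Turing machine in polynomial space has a polynomial-time many-one reduction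 to it. -/

import Mathlib

/-! ### Strategic games, state graph, sink equilibria -/

/-- A strategic game with player set `N`: player `i` has the strategies `Strat i` and
the utility `utility S i` in the strategy profile `S`. -/
structure StrategicGame (N : Type) where
  Strat : N → Type
  utility : ((i : N) → Strat i) → N → ℝ

namespace StrategicGame

variable {N : Type} [DecidableEq N]

/-- A state (strategy profile). -/
abbrev State (G : StrategicGame N) : Type := (i : N) → G.Strat i

/-- The arcs of the state graph: `S'` is obtained from `S` by a move of a single player `i`
that (strictly) improves the utility of `i`. -/
def Arc (G : StrategicGame N) (S S' : G.State) : Prop :=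
  ∃ (i : N) (s : G.Strat i), S' = Function.update S i s ∧ G.utility S i < G.utility S' i

/-- `S'` is reachable from `S` in the state graph (by a walk of length at least `0`). -/
def Reachable (G : StrategicGame N) : G.State → G.State → Prop :=
  Relation.ReflTransGen G.Arc

/-- `T` is a strongly connected component of the state graph. -/
def IsStronglyConnectedComponent (G : StrategicGame N) (T : Set G.State) : Prop :=
  ∃ S : G.State, T = {S' | G.Reachable S S' ∧ G.Reachable S' S}

/-- A sink equilibrium: a strongly connected component without outgoing arcs. -/
def IsSinkEquilibrium (G : StrategicGame N) (T : Set G.State) : Prop :=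
  G.IsStronglyConnectedComponent T ∧ ∀ S ∈ T, ∀ S', G.Arc S S' → S' ∈ T

/-- The state `S` belongs to some sink equilibrium. -/
def InASink (G : StrategicGame N) (S : G.State) : Prop :=
  ∃ T : Set G.State, G.IsSinkEquilibrium T ∧ S ∈ T

end StrategicGame

/-! ### Player-specific congestion games -/

/-- A player-specific congestion game with player set `N` and resource set `E`:
`strategies i` is the set of strategies of player `i`, each of them a set of resources, and
`delay e i k` is the delay of resource `e` for player `i` at congestion `k`. -/
structure PlayerSpecificCongestionGame (N E : Type) where
  strategies : N → Finset (Finset E)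
  delay : E → N → ℕ → ℤ

namespace PlayerSpecificCongestionGame

variable {N E : Type} [Fintype N] [DecidableEq E]

/-- A strategy profile. -/
abbrev Profile (G : PlayerSpecificCongestionGame N E) : Type :=
  (i : N) → {s : Finset E // s ∈ G.strategies i}

/-- The number of players whose strategy contains the resource `e`. -/
def congestion (G : PlayerSpecificCongestionGame N E) (S : G.Profile) (e : E) : ℕ :=
  (Finset.univ.filter fun i : N => e ∈ (S i).1).card

/-- The cost (delay) of player `i`. -/
def cost (G : PlayerSpecificCongestionGame N E) (S : G.Profile) (i : N) : ℤ :=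
  ∑ e ∈ (S i).1, G.delay e i (G.congestion S e)

/-- The strategic game given by the congestion game: utilities are negated costs. -/
def toStrategicGame (G : PlayerSpecificCongestionGame N E) : StrategicGame N where
  Strat i := {s : Finset E // s ∈ G.strategies i}
  utility S i := -((G.cost S i : ℤ) : ℝ)

end PlayerSpecificCongestionGame

/-! ### Instances of the problem and their encoding as strings -/

/-- An explicitly described instance of the problem: a player-specific congestion game with
players `Fin n` and resources `Fin m`, and a strategy profile of it. The strategies of each
player are listed, and delays are given by a table: `delayTable e i k` is the delay of
resource `e` for player `i` at congestion `k + 1`, for the possible congestions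
`1, …, n`. -/
structure InASinkInstance where
  n : ℕ
  m : ℕ
  strategyList : Fin n → List (Finset (Fin m))
  delayTable : Fin m → Fin n → Fin n → ℤ
  profile : Fin n → Finset (Fin m)
  profile_mem : ∀ i, profile i ∈ strategyList i

namespace InASinkInstance

/-- The game described by an instance. (The congestion of a resource in a strategy that is
being played always lies between `1` and `n`; other values of the delay functions play no
role and are set to `0`.) -/
def game (I : InASinkInstance) : PlayerSpecificCongestionGame (Fin I.n) (Fin I.m) where
  strategies i := (I.strategyList i).toFinset
  delay e i k := if h : 1 ≤ k ∧ k ≤ I.n then I.delayTable e i ⟨k - 1, by omega⟩ else 0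

/-- The given strategy profile, as a state of the strategic game. -/
def state (I : InASinkInstance) : I.game.toStrategicGame.State :=
  fun i => ⟨I.profile i, List.mem_toFinset.2 (I.profile_mem i)⟩

/-- The given strategy profile belongs to a sink equilibrium of the given game. -/
def IsYes (I : InASinkInstance) : Prop :=
  I.game.toStrategicGame.InASink I.state

end InASinkInstance

/-- The finite alphabet in which instances are written. -/
inductive InstanceSymbol where
  | bit (b : Bool)
  | tick
  | comma
  | semicolon
  deriving DecidableEq, Fintype

namespace InASinkInstance

open InstanceSymbol

/-- A set of resources, written as its characteristic bit vector. -/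
def encodeSet {m : ℕ} (s : Finset (Fin m)) : List InstanceSymbol :=
  (List.finRange m).map (fun e => bit (decide (e ∈ s))) ++ [comma]

/-- An integer, written as a sign bit followed by its absolute value in binary. -/
def encodeInt (z : ℤ) : List InstanceSymbol :=
  (decide (z < 0) :: Computability.encodeNat z.natAbs).map bit ++ [comma]

/-- A natural number in unary. -/
def encodeUnary (n : ℕ) : List InstanceSymbol :=
  List.replicate n tick ++ [semicolon]

/-- The list of strategies of one player. -/
def encodeStrategies {m : ℕ} (l : List (Finset (Fin m))) : List InstanceSymbol :=
  l.flatMap encodeSet ++ [semicolon]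

/-- An instance as a string: the numbers of players and resources, the strategies of every
player, the given strategy profile, and the table of delays. -/
def encode (I : InASinkInstance) : List InstanceSymbol :=
  encodeUnary I.n ++ (encodeUnary I.m ++
  ((List.finRange I.n).flatMap (fun i => encodeStrategies (I.strategyList i)) ++
  ((List.finRange I.n).flatMap (fun i => encodeSet (I.profile i)) ++
  (List.finRange I.m).flatMap (fun e => (List.finRange I.n).flatMap (fun i =>
    (List.finRange I.n).flatMap (fun k => encodeInt (I.delayTable e i k)))))))

theorem encodeUnary_append : ∀ {n n' : ℕ} {r r' : List InstanceSymbol},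
    encodeUnary n ++ r = encodeUnary n' ++ r' → n = n' ∧ r = r'
  | 0, 0, _, _, h => by simpa [encodeUnary] using h
  | 0, _ + 1, _, _, h => by simp [encodeUnary, List.replicate_succ] at h
  | _ + 1, 0, _, _, h => by simp [encodeUnary, List.replicate_succ] at h
  | n + 1, n' + 1, r, r', h => by
    have := @encodeUnary_append n n' r r' (by
      simpa [encodeUnary, List.replicate_succ] using h)
    exact ⟨by omega, this.2⟩

theorem bits_append : ∀ {l l' : List Bool} {r r' : List InstanceSymbol},
    l.map bit ++ comma :: r = l'.map bit ++ comma :: r' → l = l' ∧ r = r'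
  | [], [], _, _, h => by simpa using h
  | [], _ :: _, _, _, h => by simp at h
  | _ :: _, [], _, _, h => by simp at h
  | b :: l, b' :: l', r, r', h => by
    simp only [List.map_cons, List.cons_append, List.cons.injEq, bit.injEq] at h
    have := bits_append h.2
    exact ⟨by rw [h.1, this.1], this.2⟩

theorem encodeSet_append {m : ℕ} {s s' : Finset (Fin m)} {r r' : List InstanceSymbol}
    (h : encodeSet s ++ r = encodeSet s' ++ r') : s = s' ∧ r = r' := by
  have h' := @bits_append ((List.finRange m).map (fun e => decide (e ∈ s)))
    ((List.finRange m).map (fun e => decide (e ∈ s'))) r r'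
    (by simpa [encodeSet, List.map_map, Function.comp_def] using h)
  refine ⟨?_, h'.2⟩
  ext e
  have := List.map_inj_left.1 h'.1 e (List.mem_finRange e)
  simpa using this

theorem encodeInt_append {z z' : ℤ} {r r' : List InstanceSymbol}
    (h : encodeInt z ++ r = encodeInt z' ++ r') : z = z' ∧ r = r' := by
  have h' := @bits_append (decide (z < 0) :: Computability.encodeNat z.natAbs)
    (decide (z' < 0) :: Computability.encodeNat z'.natAbs) r r' (by simpa [encodeInt] using h)
  refine ⟨?_, h'.2⟩
  have h1 := h'.1
  rw [List.cons.injEq] at h1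
  have h2 := congrArg Computability.decodeNat h1.2
  rw [Computability.decode_encodeNat, Computability.decode_encodeNat] at h2
  have h3 : z < 0 ↔ z' < 0 := by simpa using h1.1
  omega

theorem encodeSet_ne_semicolon {m : ℕ} (s : Finset (Fin m)) (r r' : List InstanceSymbol) :
    encodeSet s ++ r ≠ semicolon :: r' := by
  unfold encodeSet
  cases h : (List.finRange m) <;> simp

theorem encodeStrategies_append {m : ℕ} : ∀ {l l' : List (Finset (Fin m))}
    {r r' : List InstanceSymbol},
    encodeStrategies l ++ r = encodeStrategies l' ++ r' → l = l' ∧ r = r'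
  | [], [], _, _, h => by simpa [encodeStrategies] using h
  | [], s :: l, _, _, h => by
    simp only [encodeStrategies, List.flatMap_cons, List.flatMap_nil, List.append_assoc,
      List.nil_append, List.singleton_append] at h
    exact absurd h.symm (encodeSet_ne_semicolon _ _ _)
  | s :: l, [], _, _, h => by
    simp only [encodeStrategies, List.flatMap_cons, List.flatMap_nil, List.append_assoc,
      List.nil_append, List.singleton_append] at h
    exact absurd h (encodeSet_ne_semicolon _ _ _)
  | s :: l, s' :: l', r, r', h => by
    simp only [encodeStrategies, List.flatMap_cons, List.append_assoc] at h
    have h1 := encodeSet_append h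
    have h2 := @encodeStrategies_append m l l' r r' (by
      simpa only [encodeStrategies, List.append_assoc] using h1.2)
    exact ⟨by rw [h1.1, h2.1], h2.2⟩

theorem flatMap_append_inj {ι α : Type} {f g : ι → List α}
    {P : ι → Prop} (H : ∀ i r r', f i ++ r = g i ++ r' → P i ∧ r = r') :
    ∀ (l : List ι) {r r' : List α}, l.flatMap f ++ r = l.flatMap g ++ r' →
      (∀ i ∈ l, P i) ∧ r = r'
  | [], _, _, h => by simpa using h
  | i :: l, r, r', h => by
    simp only [List.flatMap_cons, List.append_assoc] at h
    obtain ⟨h1, h2⟩ := H _ _ _ h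
    obtain ⟨h3, h4⟩ := flatMap_append_inj H l h2
    exact ⟨by simpa using ⟨h1, h3⟩, h4⟩

/-- Different instances have different encodings. -/
theorem encode_injective : Function.Injective encode := by
  rintro ⟨n, m, l, d, p, hp⟩ ⟨n', m', l', d', p', hp'⟩ h
  simp only [encode] at h
  obtain ⟨rfl, h⟩ := encodeUnary_append h
  obtain ⟨rfl, h⟩ := encodeUnary_append h
  obtain ⟨h1, h⟩ := flatMap_append_inj (P := fun i => l i = l' i)
    (fun i r r' h => encodeStrategies_append h) _ h
  obtain ⟨h2, h⟩ := flatMap_append_inj (P := fun i => p i = p' i)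
    (fun i r r' h => encodeSet_append h) _ h
  have h3 := (flatMap_append_inj (P := fun e => ∀ i ∈ List.finRange n, ∀ k ∈ List.finRange n,
      d e i k = d' e i k)
    (fun e r r' h => flatMap_append_inj (P := fun i => ∀ k ∈ List.finRange n,
        d e i k = d' e i k)
      (fun i r r' h => flatMap_append_inj (P := fun k => d e i k = d' e i k)
        (fun k r r' h => encodeInt_append h) _ h) _ h) _ (r := []) (r' := []) (by
          rw [h])).1
  obtain rfl : l = l' := funext fun i => h1 i (List.mem_finRange i)
  obtain rfl : p = p' := funext fun i => h2 i (List.mem_finRange i)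
  obtain rfl : d = d' := funext fun e => funext fun i => funext fun k =>
    h3 e (List.mem_finRange e) i (List.mem_finRange i) k (List.mem_finRange k)
  rfl

end InASinkInstance

/-- The problem "In a Sink" for player-specific congestion games, as a language: the strings
that encode a game together with a strategy profile that is in a sink equilibrium. -/
def inASinkPlayerSpecific : Language InstanceSymbol :=
  {w | ∃ I : InASinkInstance, I.encode = w ∧ I.IsYes}

/-! ### Turing machines, polynomial space, and hardness -/

/-- A deterministic Turing machine with one tape, infinite to the right, over the input
alphabet `{0, 1}`. -/
structure SingleTapeTM where
  State : Type
  Symbol : Type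
  [finiteState : Finite State]
  [finiteSymbol : Finite Symbol]
  blank : Symbol
  input : Bool → Symbol
  input_injective : Function.Injective input
  input_ne_blank : ∀ b, input b ≠ blank
  start : State
  accept : State
  reject : State
  accept_ne_reject : accept ≠ reject
  /-- new state, symbol to be written, and head move -/
  transition : State → Symbol → State × Symbol × Turing.Dir

namespace SingleTapeTM

/-- A configuration: state, head position, and tape content. -/
structure Config (M : SingleTapeTM) where
  state : M.State
  head : ℕ
  tape : ℕ → M.Symbol

/-- The start configuration on input `x`: the tape holds `x` followed by blanks. -/
def init (M : SingleTapeTM) (x : List Bool) : M.Config where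
  state := M.start
  head := 0
  tape j := (x[j]?).elim M.blank M.input

open Classical in
/-- One step; there is none from a configuration in the accepting or the rejecting state.
A left move from the leftmost cell leaves the head in place. -/
noncomputable def step (M : SingleTapeTM) (c : M.Config) : Option M.Config :=
  if c.state = M.accept ∨ c.state = M.reject then none
  else
    let a := M.transition c.state (c.tape c.head)
    some
      { state := a.1
        head := match a.2.2 with
          | Turing.Dir.left => c.head - 1
          | Turing.Dir.right => c.head + 1
        tape := Function.update c.tape c.head a.2.1 }

/-- `M` decides `L` in space `s`: on every input `x`, it only ever visits the first
`s |x|` tape cells, and it halts, accepting if `x ∈ L` and rejecting otherwise. -/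
def DecidesInSpace (M : SingleTapeTM) (L : Language Bool) (s : ℕ → ℕ) : Prop :=
  ∀ x : List Bool,
    (∀ c, StateTransition.Reaches M.step (M.init x) c → c.head < s x.length) ∧
    (x ∈ L → ∃ c, StateTransition.Reaches M.step (M.init x) c ∧ c.state = M.accept) ∧
    (x ∉ L → ∃ c, StateTransition.Reaches M.step (M.init x) c ∧ c.state = M.reject)

end SingleTapeTM

/-- The class of languages over `{0, 1}` that are decided by a deterministic Turing machine
in polynomial space. -/
def PSPACE : Set (Language Bool) :=
  {L | ∃ (M : SingleTapeTM) (p : Polynomial ℕ), M.DecidesInSpace L (fun k => p.eval k)}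

/-- Polynomial-time many-one reducibility. -/
def PolyTimeReducible {α β : Type} (A : Language α) (B : Language β) : Prop :=
  ∃ f : List α → List β,
    Nonempty (Turing.TM2ComputableInPolyTime (id : List α → List α) (id : List β → List β) f) ∧
    ∀ x, x ∈ A ↔ f x ∈ B

/-- Every language in `PSPACE` has a polynomial-time many-one reduction to `B`. -/
def PSPACEHard {β : Type} (B : Language β) : Prop :=
  ∀ L ∈ PSPACE, PolyTimeReducible L B

/-! A profile lies in a sink equilibrium exactly when every profile reachable from it can reach it
back (`StrategicGame.inASink_iff`). For a machine `M` deciding `L` in polynomial space, the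
reduction builds a game whose improving moves simulate `M` deterministically from the start
configuration. Acceptance closes the run into a cycle and rejection ends it in a profile without
moves, so the start profile is in a sink if and only if the input is in `L`.

The players are a control, its shadow, and one cell per tape position. Control and shadow choose a
position together with a finite control content; a cell chooses a tape symbol. Every cost is 0 or
-1. The shadow is content when it equals the control. A cell is content when the shadow stands on it
and asks for the symbol it shows. The control is content when it is a successor of the shadow's
strategy, given the symbol shown under the shadow (`cost_ctrl`, `cost_shadow`, `cost_cell`). Each
condition is a conjunction over two or three players, realised by a resource that only these players
can use and that rewards one of them at full load. This is where player-specific delays enter.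

A machine step becomes: the control reads the symbol and the shadow follows; the cell takes the new
symbol; the control advances, which it may do only after the writing; the shadow follows again. In
each intermediate profile exactly one move improves (`ControlGame.Step.transGen`). After acceptance
the control sweeps over all cells, restores the input, and returns to the start
(`transGen_restore`); after rejection nobody wants to move. Determinism along the run gives
`reflTransGen_of_cycle` and `exists_of_halts`, which combine to `reach_iff_mem`.

For polynomial-time computability, the input is padded to a word with one letter per cell. Whether a
resource belongs to a strategy depends only on the two letters involved and on whether their
positions are equal or adjacent (`inc_ctrl`, `inc_shadow`, `inc_cell`). Hence nested loops over the
word write the instance. These loops are programs on stacks, whose running times compose and which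
compile to Turing machines (`Run.iterate_step`). -/

/-! ### Structured programs on stacks, and their compilation to Turing machines -/

/-- Structured programs on a family of stacks: `pop k b` removes the top of stack `k` and
continues with `b` applied to it (to `none` if the stack is empty); `loop k b` pops stack `k`
and runs `b` on the popped symbol until the stack is empty. -/
inductive StackProg (K : Type) (Γ : K → Type) : Type
  | skip : StackProg K Γ
  | push (k : K) (a : Γ k) : StackProg K Γ
  | pop (k : K) (b : Option (Γ k) → StackProg K Γ) : StackProg K Γ
  | loop (k : K) (b : Γ k → StackProg K Γ) : StackProg K Γ
  | seq (p q : StackProg K Γ) : StackProg K Γ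

namespace StackProg

variable {K : Type} {Γ : K → Type}

section Semantics

variable [DecidableEq K]

/-- `Run p S S' t`: started with the stacks `S`, the program `p` ends with the stacks `S'` after
`t` steps. -/
inductive Run : StackProg K Γ → (∀ k, List (Γ k)) → (∀ k, List (Γ k)) → ℕ → Prop
  | skip (S) : Run skip S S 1
  | push (k a S) : Run (push k a) S (Function.update S k (a :: S k)) 1
  | pop {k b S S' t} (h : Run (b (S k).head?) (Function.update S k (S k).tail) S' t) :
      Run (pop k b) S S' (t + 1)
  | loop_nil {k b S} (h : S k = []) : Run (loop k b) S S 1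
  | loop_cons {k b S a l S' S'' t t'} (h : S k = a :: l)
      (h1 : Run (b a) (Function.update S k l) S' t) (h2 : Run (loop k b) S' S'' t') :
      Run (loop k b) S S'' (t' + (t + 1))
  | seq {p q S S' S'' t t'} (h1 : Run p S S' t) (h2 : Run q S' S'' t') :
      Run (seq p q) S S'' (t' + t)

/-- `RunsIn p S S' n`: started with `S`, the program `p` ends with `S'` after at most `n` steps. -/
def RunsIn (p : StackProg K Γ) (S S' : ∀ k, List (Γ k)) (n : ℕ) : Prop :=
  ∃ t ≤ n, Run p S S' t

theorem RunsIn.mono {p : StackProg K Γ} {S S' : ∀ k, List (Γ k)} {n n' : ℕ}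
    (h : RunsIn p S S' n) (hn : n ≤ n') : RunsIn p S S' n' := by
  obtain ⟨t, ht, h⟩ := h
  exact ⟨t, ht.trans hn, h⟩

theorem RunsIn.seq {p q : StackProg K Γ} {S S' S'' : ∀ k, List (Γ k)} {n n' : ℕ}
    (h : RunsIn p S S' n) (h' : RunsIn q S' S'' n') : RunsIn (seq p q) S S'' (n + n') := by
  obtain ⟨t, ht, h⟩ := h
  obtain ⟨t', ht', h'⟩ := h'
  exact ⟨t' + t, by omega, h.seq h'⟩

theorem RunsIn.skip (S : ∀ k, List (Γ k)) : RunsIn (K := K) skip S S 1 :=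
  ⟨1, le_rfl, .skip S⟩

theorem RunsIn.push (k : K) (a : Γ k) {S S' : ∀ k, List (Γ k)}
    (h : S' = Function.update S k (a :: S k)) : RunsIn (push k a) S S' 1 :=
  ⟨1, le_rfl, h ▸ .push k a S⟩

theorem RunsIn.pop {k : K} {b : Option (Γ k) → StackProg K Γ} {S S₁ S' : ∀ k, List (Γ k)} {n : ℕ}
    (h : S₁ = Function.update S k (S k).tail) (h1 : RunsIn (b (S k).head?) S₁ S' n) :
    RunsIn (pop k b) S S' (n + 1) := by
  obtain ⟨t, ht, h1⟩ := h1
  exact ⟨t + 1, by omega, .pop (h ▸ h1)⟩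

theorem RunsIn.loop_nil {k : K} {b : Γ k → StackProg K Γ} {S : ∀ k, List (Γ k)} (h : S k = []) :
    RunsIn (loop k b) S S 1 :=
  ⟨1, le_rfl, .loop_nil h⟩

theorem RunsIn.loop_cons {k : K} {b : Γ k → StackProg K Γ} {S S₁ S' S'' : ∀ k, List (Γ k)}
    {a : Γ k} {l : List (Γ k)} {n n' : ℕ} (h : S k = a :: l) (hS : S₁ = Function.update S k l)
    (h1 : RunsIn (b a) S₁ S' n) (h2 : RunsIn (loop k b) S' S'' n') :
    RunsIn (loop k b) S S'' (n' + (n + 1)) := by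
  subst hS
  obtain ⟨t, ht, h1⟩ := h1
  obtain ⟨t', ht', h2⟩ := h2
  exact ⟨t' + (t + 1), by omega, .loop_cons h h1 h2⟩

/-- A loop, from a description of the state by the popped symbols (in reverse order) and the
remaining symbols. -/
theorem RunsIn.loop {k : K} {b : Γ k → StackProg K Γ}
    (st : List (Γ k) → List (Γ k) → ∀ k, List (Γ k)) (n : ℕ) (hk : ∀ d r, st d r k = r)
    (l : List (Γ k)) (hb : ∀ d a r, d.reverse ++ a :: r = l →
      RunsIn (b a) (Function.update (st d (a :: r)) k r) (st (a :: d) r) n) :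
    RunsIn (loop k b) (st [] l) (st l.reverse []) (l.length * (n + 1) + 1) := by
  suffices H : ∀ r d, d.reverse ++ r = l →
      RunsIn (StackProg.loop k b) (st d r) (st l.reverse []) (r.length * (n + 1) + 1) from
    H l [] rfl
  intro r
  induction r with
  | nil =>
    intro d hd
    obtain rfl : d = l.reverse := by rw [← hd]; simp
    simpa using RunsIn.loop_nil (hk _ _)
  | cons a r ih =>
    intro d hd
    refine (RunsIn.loop_cons (hk _ _) rfl (hb d a r hd) (ih (a :: d) (by simpa using hd))).mono ?_
    rw [List.length_cons, Nat.succ_mul]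
    omega

/-- Run several programs one after another. -/
def seqs {ι : Type*} (p : ι → StackProg K Γ) : List ι → StackProg K Γ
  | [] => StackProg.skip
  | i :: l => StackProg.seq (p i) (seqs p l)

end Semantics

/-! ### Compilation of stack programs to multi-stack Turing machines -/

section Compile

/-- The labels of the machine that runs a program. -/
def Label : StackProg K Γ → Type
  | skip => Unit
  | push _ _ => Unit
  | pop _ b => Option (Σ o, Label (b o))
  | loop _ b => Option (Σ a, Label (b a))
  | seq p q => Label p ⊕ Label q

/-- The label at which the execution of a program begins. -/
def entry : (p : StackProg K Γ) → Label p
  | skip => ()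
  | push _ _ => ()
  | pop _ _ => none
  | loop _ _ => none
  | seq p _ => Sum.inl p.entry

theorem finite_label [∀ k, Finite (Γ k)] : ∀ p : StackProg K Γ, Finite (Label p)
  | skip => inferInstanceAs (Finite Unit)
  | push _ _ => inferInstanceAs (Finite Unit)
  | pop _ b =>
    have := fun o => finite_label (b o)
    inferInstanceAs (Finite (Option (Σ o, Label (b o))))
  | loop _ b =>
    have := fun o => finite_label (b o)
    inferInstanceAs (Finite (Option (Σ o, Label (b o))))
  | seq p q =>
    have := finite_label p
    have := finite_label q
    inferInstanceAs (Finite (Label p ⊕ Label q))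

variable [DecidableEq K]

/-- The symbol of stack `k` that is stored in a register. -/
def stored (k : K) : Option (Σ k, Γ k) → Option (Γ k)
  | none => none
  | some ⟨k', a⟩ => if h : k' = k then some (h ▸ a) else none

@[simp]
theorem stored_map (k : K) (o : Option (Γ k)) :
    stored k (o.map fun a => (⟨k, a⟩ : Σ k, Γ k)) = o := by
  cases o <;> simp [stored]

/-- The statement that belongs to a label of a program, when the labels of the program are
embedded into `Λ` and execution is to continue at `exit` after the program has ended. -/
def code {Λ : Type} : (p : StackProg K Γ) → (Label p → Λ) → Λ → Label p →
    Turing.TM2.Stmt Γ Λ (Option (Σ k, Γ k))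
  | skip, _, exit, _ => .goto fun _ => exit
  | push k a, _, exit, _ => .push k (fun _ => a) (.goto fun _ => exit)
  | pop k b, emb, _, none => .pop k (fun _ o => o.map fun a => ⟨k, a⟩)
      (.goto fun v => emb (some ⟨stored k v, (b (stored k v)).entry⟩))
  | pop _ b, emb, exit, some ⟨o, l⟩ => (b o).code (fun l => emb (some ⟨o, l⟩)) exit l
  | loop k b, emb, exit, none => .pop k (fun _ o => o.map fun a => ⟨k, a⟩)
      (.goto fun v => match stored k v with
        | none => exit
        | some a => emb (some ⟨a, (b a).entry⟩))
  | loop _ b, emb, _, some ⟨a, l⟩ => (b a).code (fun l => emb (some ⟨a, l⟩)) (emb none) l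
  | seq p q, emb, _, Sum.inl l => p.code (fun l => emb (Sum.inl l)) (emb (Sum.inr q.entry)) l
  | seq _ q, emb, exit, Sum.inr l => q.code (fun l => emb (Sum.inr l)) exit l

/-- Quantifying over `emb` and `exit` makes the induction hypothesis applicable to subprograms,
whose labels are part of a larger label set and which continue at different labels; the body of a
loop exits to the head of that loop. The register may hold anything on entry, because every `pop` or
`loop` overwrites it before inspecting it. -/
theorem Run.iterate_step {Λ : Type} (M : Λ → Turing.TM2.Stmt Γ Λ (Option (Σ k, Γ k)))
    {p : StackProg K Γ} {S S' : ∀ k, List (Γ k)} {t : ℕ} (h : Run p S S' t) :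
    ∀ (emb : Label p → Λ) (exit : Λ), (∀ l, M (emb l) = p.code emb exit l) → ∀ v, ∃ v',
      (flip bind (Turing.TM2.step M))^[t] (some ⟨some (emb p.entry), v, S⟩) =
        some ⟨some exit, v', S'⟩ := by
  induction h with
  | skip S =>
    intro emb exit hM v
    have h0 : M (emb ()) = _ := hM ()
    exact ⟨v, by simp [flip, entry, h0, code, Turing.TM2.step]⟩
  | push k a S =>
    intro emb exit hM v
    have h0 : M (emb ()) = _ := hM ()
    exact ⟨v, by simp [flip, entry, h0, code, Turing.TM2.step]⟩
  | @pop k b S S' t h ih =>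
    intro emb exit hM v
    obtain ⟨v', hv'⟩ := ih (fun l => emb (some ⟨_, l⟩)) exit (fun l => hM (some ⟨_, l⟩))
      ((S k).head?.map fun a => ⟨k, a⟩)
    refine ⟨v', ?_⟩
    rw [Function.iterate_add_apply, ← hv']
    congr 1
    have h0 : M (emb none) = _ := hM none
    simp only [flip, entry, h0, code, Turing.TM2.step, Function.iterate_one, Option.bind_eq_bind,
      Option.bind_some, Turing.TM2.stepAux]
    exact congrArg (fun o => some (Turing.TM2.Cfg.mk (some (emb (some ⟨o, (b o).entry⟩)))
      ((S k).head?.map fun a => (⟨k, a⟩ : Σ k, Γ k)) (Function.update S k (S k).tail)))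
      (stored_map k _)
  | @loop_nil k b S h =>
    intro emb exit hM v
    have h0 : M (emb none) = _ := hM none
    refine ⟨none, ?_⟩
    simp [flip, entry, h0, code, Turing.TM2.step, h, stored]
  | @loop_cons k b S a l S' S'' t t' h h1 h2 ih1 ih2 =>
    intro emb exit hM v
    obtain ⟨v₁, hv₁⟩ := ih1 (fun l => emb (some ⟨_, l⟩)) (emb none) (fun l => hM (some ⟨_, l⟩))
      (some ⟨k, a⟩)
    obtain ⟨v', hv'⟩ := ih2 emb exit hM v₁
    refine ⟨v', ?_⟩
    rw [Function.iterate_add_apply, Function.iterate_add_apply, ← hv']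
    congr 1
    refine Eq.trans ?_ hv₁
    congr 1
    have h0 : M (emb none) = _ := hM none
    simp [flip, entry, h0, code, Turing.TM2.step, h, stored]
  | @seq p q S S' S'' t t' h1 h2 ih1 ih2 =>
    intro emb exit hM v
    obtain ⟨v₁, hv₁⟩ := ih1 (fun l => emb (Sum.inl l)) (emb (Sum.inr q.entry))
      (fun l => hM (Sum.inl l)) v
    obtain ⟨v', hv'⟩ := ih2 (fun l => emb (Sum.inr l)) exit (fun l => hM (Sum.inr l)) v₁
    refine ⟨v', ?_⟩
    rw [Function.iterate_add_apply, ← hv']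
    congr 1

/-- The Turing machine that runs a program. -/
noncomputable def machine [Fintype K] [∀ k, Fintype (Γ k)] (p : StackProg K Γ) (k₀ k₁ : K) :
    Turing.FinTM2 :=
  have := finite_label p
  have : Fintype (Option p.Label) := Fintype.ofFinite _
  { K := K
    k₀ := k₀
    k₁ := k₁
    Γ := Γ
    Λ := Option p.Label
    main := some p.entry
    σ := Option (Σ k, Γ k)
    initialState := none
    m := fun
      -- The required final configuration has its register in the initial state, so one extra step
      -- resets it before halting.
      | none => .load (fun _ => none) .halt
      | some l => p.code some none l }

/-- The left side is the form in which `Turing.initList` and `Turing.haltList` present their stacks.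
-/
theorem dite_eq_update (k₀ : K) (x : List (Γ k₀)) (k : K) :
    (if h : k = k₀ then (by rw [h]; exact x) else [] : List (Γ k)) =
      Function.update (fun _ => []) k₀ x k := by
  by_cases hk : k = k₀
  · subst hk
    simp
  · simp [hk]

/-- A function that is computed in polynomial time by a structured program on stacks is
computable in polynomial time. -/
theorem nonempty_tm2ComputableInPolyTime [Fintype K] [∀ k, Fintype (Γ k)] (p : StackProg K Γ)
    (k₀ k₁ : K) (f : List (Γ k₀) → List (Γ k₁)) (P : Polynomial ℕ)
    (h : ∀ x, RunsIn p (Function.update (fun _ => []) k₀ x) (Function.update (fun _ => []) k₁ (f x))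
      (P.eval x.length)) :
    Nonempty (Turing.TM2ComputableInPolyTime (id : List (Γ k₀) → _) (id : List (Γ k₁) → _) f) := by
  refine ⟨{ tm := machine p k₀ k₁, inputAlphabet := Equiv.refl _, outputAlphabet := Equiv.refl _,
            time := P + 1, outputsFun := fun x => ?_ }⟩
  have hx := h x
  refine ⟨⟨hx.choose + 1, ?_⟩, ?_⟩
  · obtain ⟨v', hv'⟩ := hx.choose_spec.2.iterate_step (machine p k₀ k₁).m some none
      (fun l => rfl) none
    rw [add_comm, Function.iterate_add_apply]
    have m1 : List.map (Equiv.refl (Γ k₀)).invFun (id x) = x := List.map_id x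
    have m2 : List.map (Equiv.refl (Γ k₁)).invFun (id (f x)) = f x := List.map_id (f x)
    have e1 : Turing.initList (machine p k₀ k₁) x =
        ⟨some (some p.entry), none, Function.update (fun _ => []) k₀ x⟩ :=
      congrArg (Turing.TM2.Cfg.mk _ _) (funext fun k => dite_eq_update k₀ x k)
    have e2 : Turing.haltList (machine p k₀ k₁) (f x) =
        ⟨none, none, Function.update (fun _ => []) k₁ (f x)⟩ :=
      congrArg (Turing.TM2.Cfg.mk _ _) (funext fun k => dite_eq_update k₁ (f x) k)
    erw [m1, m2, e1, hv']
    exact congrArg some e2.symm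
  · simpa using hx.choose_spec.1

end Compile

end StackProg

/-! ### Programs that write words by nested loops over the positions of a word -/

/-- The letters of a word: a tape symbol (`none` for a blank), and whether the position is the first
or the last one. -/
structure Letter where
  sym : Option Bool
  first : Bool
  last : Bool
  deriving DecidableEq, Fintype

/-- The relation of a position to a given position. -/
inductive Mark where
  | far
  | pred
  | same
  | succ
  deriving DecidableEq

instance : Fintype Mark := ⟨{.far, .pred, .same, .succ}, fun x => by cases x <;> decide⟩

/-- The stacks of the programs. -/
inductive Stk where
  | inp
  | base
  | baseCopy
  | count
  | countCopy
  | word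
  | left
  | right
  | tmp
  | preMarks
  | marks
  | rev
  | out
  deriving DecidableEq

instance : Fintype Stk :=
  ⟨{.inp, .base, .baseCopy, .count, .countCopy, .word, .left, .right, .tmp, .preMarks, .marks,
    .rev, .out}, fun x => by cases x <;> decide⟩

/-- The symbols on a stack. -/
@[reducible]
def Stk.Sym : Stk → Type
  | .inp => Bool
  | .base => Unit
  | .baseCopy => Unit
  | .count => Unit
  | .countCopy => Unit
  | .word => Letter
  | .left => Letter
  | .right => Letter
  | .tmp => Letter
  | .preMarks => Letter × Mark
  | .marks => Letter × Mark
  | .rev => InstanceSymbol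
  | .out => InstanceSymbol

instance : ∀ k : Stk, Fintype k.Sym
  | .inp => inferInstanceAs (Fintype Bool)
  | .base => inferInstanceAs (Fintype Unit)
  | .baseCopy => inferInstanceAs (Fintype Unit)
  | .count => inferInstanceAs (Fintype Unit)
  | .countCopy => inferInstanceAs (Fintype Unit)
  | .word => inferInstanceAs (Fintype Letter)
  | .left => inferInstanceAs (Fintype Letter)
  | .right => inferInstanceAs (Fintype Letter)
  | .tmp => inferInstanceAs (Fintype Letter)
  | .preMarks => inferInstanceAs (Fintype (Letter × Mark))
  | .marks => inferInstanceAs (Fintype (Letter × Mark))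
  | .rev => inferInstanceAs (Fintype InstanceSymbol)
  | .out => inferInstanceAs (Fintype InstanceSymbol)

/-- The contents of all stacks but the one to which the output is written. -/
structure Mem where
  inp : List Bool := []
  base : List Unit := []
  baseCopy : List Unit := []
  count : List Unit := []
  countCopy : List Unit := []
  word : List Letter := []
  left : List Letter := []
  right : List Letter := []
  tmp : List Letter := []
  preMarks : List (Letter × Mark) := []
  marks : List (Letter × Mark) := []
  out : List InstanceSymbol := []

/-- The contents of the stacks. -/
def Mem.stacks (m : Mem) (rv : List InstanceSymbol) : ∀ k : Stk, List k.Sym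
  | .inp => m.inp
  | .base => m.base
  | .baseCopy => m.baseCopy
  | .count => m.count
  | .countCopy => m.countCopy
  | .word => m.word
  | .left => m.left
  | .right => m.right
  | .tmp => m.tmp
  | .preMarks => m.preMarks
  | .marks => m.marks
  | .rev => rv
  | .out => m.out

/-- Programs on these stacks. -/
abbrev Prog : Type := StackProg Stk Stk.Sym

open StackProg

theorem runsIn_push (k : Stk) (a : k.Sym) {S S' : ∀ k : Stk, List k.Sym}
    (h : S' = Function.update S k (a :: S k)) : RunsIn (.push k a : Prog) S S' 1 :=
  RunsIn.push k a h

theorem runsIn_loop (k : Stk) {b : k.Sym → Prog}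
    (st : List k.Sym → List k.Sym → ∀ k : Stk, List k.Sym) (n : ℕ)
    (hk : ∀ d r, st d r k = r) (l : List k.Sym)
    (hb : ∀ d a r, d.reverse ++ a :: r = l →
      RunsIn (b a) (Function.update (st d (a :: r)) k r) (st (a :: d) r) n) :
    RunsIn (.loop k b : Prog) (st [] l) (st l.reverse []) (l.length * (n + 1) + 1) :=
  RunsIn.loop st n hk l hb

/-- In every state satisfying `C`, the program `p` writes `F`, leaves the other stacks as they are,
and takes time polynomial in the length of the word. -/
def Emits (C : Mem → Prop) (p : Prog) (F : Mem → List InstanceSymbol) : Prop :=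
  ∃ P : Polynomial ℕ, ∀ m rv, C m →
    RunsIn p (m.stacks rv) (m.stacks ((F m).reverse ++ rv)) (P.eval m.word.length)

namespace Emits

variable {C : Mem → Prop} {p q : Prog} {F G : Mem → List InstanceSymbol}

theorem mono {C' : Mem → Prop} (h : Emits C p F) (hC : ∀ m, C' m → C m) : Emits C' p F := by
  obtain ⟨P, hP⟩ := h
  exact ⟨P, fun m rv hm => hP m rv (hC m hm)⟩

theorem congr (h : Emits C p F) (hF : ∀ m, C m → F m = G m) : Emits C p G := by
  obtain ⟨P, hP⟩ := h
  exact ⟨P, fun m rv hm => hF m hm ▸ hP m rv hm⟩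

theorem skip : Emits C StackProg.skip (fun _ => []) :=
  ⟨1, fun m rv _ => by simpa using RunsIn.skip _⟩

theorem seq (hp : Emits C p F) (hq : Emits C q G) :
    Emits C (StackProg.seq p q) (fun m => F m ++ G m) := by
  obtain ⟨P, hP⟩ := hp
  obtain ⟨Q, hQ⟩ := hq
  refine ⟨P + Q, fun m rv hm => ?_⟩
  have := (hP m rv hm).seq (hQ m _ hm)
  simpa using this

theorem seqs {ι : Type*} {p : ι → Prog} {F : ι → Mem → List InstanceSymbol}
    (h : ∀ i, Emits C (p i) (F i)) : ∀ l : List ι,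
      Emits C (StackProg.seqs p l) (fun m => l.flatMap fun i => F i m)
  | [] => skip
  | i :: l => by
    simpa [StackProg.seqs] using (h i).seq (seqs h l)

end Emits

/-- Write a fixed word. -/
def emit (l : List InstanceSymbol) : Prog :=
  seqs (fun a => .push .rev a) l

theorem runsIn_emit : ∀ (l : List InstanceSymbol) (m : Mem) (rv : List InstanceSymbol),
    RunsIn (emit l) (m.stacks rv) (m.stacks (l.reverse ++ rv)) (2 * l.length + 1)
  | [], m, rv => RunsIn.skip _
  | a :: l, m, rv => by
    have h := RunsIn.seq (runsIn_push (S := m.stacks rv) (S' := m.stacks (a :: rv))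
      Stk.rev a (by funext k; cases k <;> rfl)) (runsIn_emit l m (a :: rv))
    simp only [List.reverse_cons, List.append_assoc, List.singleton_append, List.length_cons]
    exact h.mono (by omega)

theorem emits_emit {C : Mem → Prop} (l : List InstanceSymbol) :
    Emits C (emit l) (fun _ => l) :=
  ⟨Polynomial.C (2 * l.length + 1), fun m rv _ => by
    simpa only [Polynomial.eval_C] using runsIn_emit l m rv⟩

/-- A common bound for finitely many polynomials. -/
theorem exists_polynomial_forall {α : Type*} [Finite α] (P : α → Polynomial ℕ) :
    ∃ Q : Polynomial ℕ, ∀ a n, (P a).eval n ≤ Q.eval n := by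
  have := Fintype.ofFinite α
  refine ⟨∑ a, P a, fun a n => ?_⟩
  rw [Polynomial.eval_finsetSum]
  exact Finset.single_le_sum (f := fun a => (P a).eval n) (fun _ _ => Nat.zero_le _)
    (Finset.mem_univ a)

/-- The body of a loop depends on the popped symbol. As the alphabet is finite, one polynomial
bounds the running times of all variants of the body. -/
theorem Emits.exists_uniform {α : Type*} [Finite α] {C : α → Mem → Prop} {p : α → Prog}
    {F : α → Mem → List InstanceSymbol} (h : ∀ a, Emits (C a) (p a) (F a)) :
    ∃ P : Polynomial ℕ, ∀ a m rv, C a m →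
      RunsIn (p a) (m.stacks rv) (m.stacks ((F a m).reverse ++ rv)) (P.eval m.word.length) := by
  choose P hP using h
  obtain ⟨Q, hQ⟩ := exists_polynomial_forall P
  exact ⟨Q, fun a m rv hm => (hP a m rv hm).mono (hQ a _)⟩

/-! ### One pass over the word, and marking the word relative to a position -/

section Loops

variable (m : Mem) (rv : List InstanceSymbol)

/-- Move `tmp` to `word`. -/
def restoreWord : Prog := .loop .tmp fun a => .push .word a

theorem runsIn_restoreWord (l w : List Letter) :
    RunsIn restoreWord ({ m with word := w, tmp := l }.stacks rv)
      ({ m with word := l.reverse ++ w, tmp := [] }.stacks rv) (l.length * 2 + 1) := by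
  have h := runsIn_loop Stk.tmp (b := fun a => .push .word a) (fun d r =>
    { m with word := d ++ w, tmp := r }.stacks rv) 1 (fun _ _ => rfl) l
      fun _ a _ _ => runsIn_push .word a (by funext k; cases k <;> rfl)
  exact h

/-- Write `f a` for every letter `a` of the word. -/
def forWord (f : Letter → List InstanceSymbol) : Prog :=
  .seq (.loop .word fun a => .seq (.push .tmp a) (emit (f a))) restoreWord

theorem emits_forWord (f : Letter → List InstanceSymbol) :
    Emits (fun m => m.tmp = []) (forWord f) (fun m => m.word.flatMap f) := by
  set c := ∑ a, (2 * (f a).length + 1)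
  have hc : ∀ a, 2 * (f a).length + 1 ≤ c := fun a =>
    Finset.single_le_sum (f := fun a => 2 * (f a).length + 1) (fun _ _ => Nat.zero_le _)
      (Finset.mem_univ a)
  refine ⟨Polynomial.X * Polynomial.C (c + 4) + 2, fun m rv hm => ?_⟩
  have h1 := runsIn_loop Stk.word (b := fun a => StackProg.seq (.push .tmp a) (emit (f a)))
    (fun d r => { m with word := r, tmp := d }.stacks ((d.reverse.flatMap f).reverse ++ rv))
    (1 + c) (fun _ _ => rfl) m.word (fun d a r _ =>
      RunsIn.seq (S' := { m with word := r, tmp := a :: d }.stacks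
          ((d.reverse.flatMap f).reverse ++ rv))
        (runsIn_push .tmp a (by funext k; cases k <;> rfl))
        (by simpa using (runsIn_emit (f a) { m with word := r, tmp := a :: d } _).mono (hc a)))
  have h2 := runsIn_restoreWord m ((m.word.flatMap f).reverse ++ rv) m.word.reverse []
  have e : { m with tmp := [] } = m := by cases m; simp_all
  simp only [List.reverse_reverse] at h1
  have h := h1.seq h2
  simp only [List.reverse_reverse, List.append_nil, List.reverse_nil, List.flatMap_nil,
    List.nil_append, e] at h
  refine h.mono ?_
  simp
  ring_nf; omega

/-- The letters before a position, from right to left, with their marks. -/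
def markBack : List Letter → List (Letter × Mark)
  | [] => []
  | b :: l => (b, .pred) :: l.map fun b => (b, .far)

/-- The letters after a position with their marks. -/
def markAhead : List Letter → List (Letter × Mark)
  | [] => []
  | b :: l => (b, .succ) :: l.map fun b => (b, .far)

/-- A word with the marks for a position; it is given by the letters before the position (from
right to left), the letter at the position, and the letters after the position. -/
def marked (l : List Letter) (a : Letter) (r : List Letter) : List (Letter × Mark) :=
  (markBack l).reverse ++ (a, .same) :: markAhead r

@[simp]
theorem length_marked (l : List Letter) (a : Letter) (r : List Letter) :
    (marked l a r).length = l.length + 1 + r.length := by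
  cases l <;> cases r <;> simp [marked, markBack, markAhead] <;> omega

theorem map_fst_markBack (l : List Letter) : (markBack l).map Prod.fst = l := by
  cases l <;> simp [markBack, Function.comp_def]

/-- Move `left` to `marks`, with marks. -/
def pushBack : Prog :=
  .pop .left fun
    | none => .skip
    | some b => .seq (.push .marks (b, .pred)) (.loop .left fun b => .push .marks (b, .far))

theorem runsIn_pushBack (l : List Letter) :
    RunsIn pushBack ({ m with left := l, marks := [] }.stacks rv)
      ({ m with left := [], marks := (markBack l).reverse }.stacks rv) (2 * l.length + 3) := by
  cases l with
  | nil =>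
    refine (RunsIn.pop (S₁ := { m with left := [], marks := [] }.stacks rv)
      (by funext k; cases k <;> rfl) (RunsIn.skip _)).mono ?_
    simp
  | cons b l =>
    have h := runsIn_loop Stk.left (b := fun b => (StackProg.push Stk.marks (b, Mark.far) : Prog))
      (fun d r =>
        { m with left := r, marks := (d.map fun b => (b, Mark.far)) ++ [(b, Mark.pred)] }.stacks rv)
      1 (fun _ _ => rfl) l fun _ b _ _ => runsIn_push .marks (b, Mark.far) (by
        funext k; cases k <;> rfl)
    have h' := RunsIn.seq (runsIn_push
      (S := { m with left := l, marks := [] }.stacks rv)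
      (S' := { m with left := l, marks := [(b, .pred)] }.stacks rv) Stk.marks (b, Mark.pred)
      (by funext k; cases k <;> rfl)) h
    simp only [markBack, List.reverse_cons, ← List.map_reverse]
    refine (RunsIn.pop (S₁ := { m with left := l, marks := [] }.stacks rv)
      (by funext k; cases k <;> rfl) h').mono ?_
    simp; omega

/-- Move `marks` to `left` and to `preMarks`. -/
def restoreLeft : Prog :=
  .loop .marks fun b => .seq (.push .left b.1) (.push .preMarks b)

theorem runsIn_restoreLeft (ms : List (Letter × Mark)) :
    RunsIn restoreLeft ({ m with left := [], preMarks := [], marks := ms }.stacks rv)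
      ({ m with left := ms.reverse.map Prod.fst, preMarks := ms.reverse, marks := [] }.stacks rv)
      (ms.length * 3 + 1) := by
  have h := runsIn_loop Stk.marks (fun d r =>
        { m with left := d.map Prod.fst, preMarks := d, marks := r }.stacks rv) 2
          (fun _ _ => rfl) ms
      fun d b r _ => RunsIn.seq (S' :=
        { m with left := b.1 :: d.map Prod.fst, preMarks := d, marks := r }.stacks rv)
        (runsIn_push .left b.1 (by funext k; cases k <;> rfl))
        (runsIn_push .preMarks b (by funext k; cases k <;> rfl))
  exact h

/-- Move `right` to `tmp`, and to `preMarks` with marks. -/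
def pushAhead : Prog :=
  .pop .right fun
    | none => .skip
    | some b => .seq (.seq (.push .preMarks (b, .succ)) (.push .tmp b))
        (.loop .right fun b => .seq (.push .preMarks (b, .far)) (.push .tmp b))

theorem runsIn_pushAhead (l : List Letter) (ms : List (Letter × Mark)) :
    RunsIn pushAhead ({ m with right := l, tmp := [], preMarks := ms }.stacks rv)
      ({ m with right := [], tmp := l.reverse, preMarks := (markAhead l).reverse ++ ms }.stacks rv) (3 * l.length + 4) := by
  cases l with
  | nil =>
    refine (RunsIn.pop (S₁ := { m with right := [], tmp := [], preMarks := ms }.stacks rv)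
      (by funext k; cases k <;> rfl) (RunsIn.skip _)).mono ?_
    simp
  | cons b l =>
    have h := runsIn_loop Stk.right (b := fun b => (StackProg.seq (.push Stk.preMarks (b,
      Mark.far)) (.push Stk.tmp b) : Prog))
      (fun d r =>
        { m with right := r, tmp := d ++ [b], preMarks := (d.map fun b => (b, Mark.far)) ++ (b, Mark.succ) :: ms }.stacks rv)
      2 (fun _ _ => rfl) l fun d b' r _ =>
        RunsIn.seq (S' :=
          { m with right := r, tmp := d ++ [b], preMarks := (b', Mark.far) :: (d.map fun b => (b, Mark.far)) ++ (b, Mark.succ) :: ms }.stacks rv)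
          (runsIn_push .preMarks (b', Mark.far) (by funext k; cases k <;> rfl))
          (runsIn_push .tmp b' (by funext k; cases k <;> rfl))
    have h' := RunsIn.seq (RunsIn.seq (runsIn_push
      (S := { m with right := l, tmp := [], preMarks := ms }.stacks rv)
      (S' := { m with right := l, tmp := [], preMarks := (b, .succ) :: ms }.stacks rv)
      Stk.preMarks (b, Mark.succ) (by funext k; cases k <;> rfl))
      (runsIn_push
      (S' := { m with right := l, tmp := [b], preMarks := (b, .succ) :: ms }.stacks rv)
      Stk.tmp b (by funext k; cases k <;> rfl))) h
    simp only [markAhead, List.reverse_cons, ← List.map_reverse, List.append_assoc,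
      List.singleton_append]
    refine (RunsIn.pop (S₁ := { m with right := l, tmp := [], preMarks := ms }.stacks rv)
      (by funext k; cases k <;> rfl) h').mono ?_
    simp; omega

/-- Move `tmp` to `right`. -/
def restoreRight : Prog := .loop .tmp fun a => .push .right a

theorem runsIn_restoreRight (l : List Letter) :
    RunsIn restoreRight ({ m with right := [], tmp := l }.stacks rv)
      ({ m with right := l.reverse, tmp := [] }.stacks rv) (l.length * 2 + 1) := by
  have h := runsIn_loop Stk.tmp (fun d r => { m with right := d, tmp := r }.stacks rv) 1
    (fun _ _ => rfl) l
      fun _ a _ _ => runsIn_push .right a (by funext k; cases k <;> rfl)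
  exact h

/-- Move `preMarks` to `marks`. -/
def moveMarks : Prog := .loop .preMarks fun a => .push .marks a

theorem runsIn_moveMarks (l : List (Letter × Mark)) :
    RunsIn moveMarks ({ m with preMarks := l, marks := [] }.stacks rv)
      ({ m with preMarks := [], marks := l.reverse }.stacks rv) (l.length * 2 + 1) := by
  have h := runsIn_loop Stk.preMarks (fun d r => { m with preMarks := r, marks := d }.stacks rv) 1
    (fun _ _ => rfl) l
      fun _ a _ _ => runsIn_push .marks a (by funext k; cases k <;> rfl)
  exact h

/-- Put the word with the marks for the current position onto the stack `marks`. -/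
def buildMarks (a : Letter) : Prog :=
  .seq pushBack (.seq restoreLeft (.seq (.push .preMarks (a, .same))
    (.seq pushAhead (.seq restoreRight moveMarks))))

/-- Both sides of the current position have to be copied without being lost. Since moving a stack
reverses it, each side passes through an auxiliary stack and is put back, and the marked word,
collected in reverse on `preMarks`, is turned around at the end. -/
theorem runsIn_buildMarks (l r : List Letter) (a : Letter) :
    RunsIn (buildMarks a)
      ({ m with left := l, right := r, tmp := [], preMarks := [], marks := [] }.stacks rv)
      ({ m with left := l, right := r, tmp := [], preMarks := [], marks := marked l a r }.stacks rv)
      (7 * (l.length + 1 + r.length) + 7) := by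
  have h1 := runsIn_pushBack { m with right := r, tmp := [], preMarks := [] } rv l
  have h2 := runsIn_restoreLeft { m with right := r, tmp := [] } rv (markBack l).reverse
  have h3 := runsIn_push
    (S := { m with left := l, right := r, tmp := [], preMarks := markBack l, marks := [] }.stacks rv)
    (S' := { m with left := l, right := r, tmp := [], preMarks := (a, .same) :: markBack l, marks := [] }.stacks rv)
    Stk.preMarks (a, Mark.same) (by funext k; cases k <;> rfl)
  have h4 := runsIn_pushAhead { m with left := l, marks := [] } rv r ((a, .same) :: markBack l)
  have h5 := runsIn_restoreRight
    { m with left := l, marks := [], preMarks := (markAhead r).reverse ++ (a, .same) :: markBack l } rv r.reverse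
  have h6 := runsIn_moveMarks { m with left := l, right := r, tmp := [] } rv
    ((markAhead r).reverse ++ (a, .same) :: markBack l)
  simp only [List.reverse_reverse, map_fst_markBack] at h2 h5
  have e : ((markAhead r).reverse ++ (a, Mark.same) :: markBack l).reverse = marked l a r := by
    simp [marked]
  rw [e] at h6
  refine (h1.seq (h2.seq (h3.seq (h4.seq (h5.seq h6))))).mono ?_
  have e1 : (markBack l).length = l.length := by cases l <;> simp [markBack]
  have e2 : (markAhead r).length = r.length := by cases r <;> simp [markAhead]
  simp [e1, e2]
  omega

end Loops

/-- The state in an iteration of a loop over the positions of the word, at a position with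
letter `a`. -/
def AtPosition (a : Letter) (m : Mem) : Prop :=
  m.word = m.left.reverse ++ a :: m.right ∧ m.tmp = [] ∧ m.preMarks = [] ∧ m.marks = []

/-- Run `body` for all letters of the word, marked for the current position. -/
def forMarks (a : Letter) (body : Letter × Mark → Prog) : Prog :=
  .seq (buildMarks a) (.loop .marks body)

theorem emits_forMarks (a : Letter) {body : Letter × Mark → Prog}
    {F : Letter × Mark → List Letter → List InstanceSymbol}
    (h : ∀ b, Emits (fun m => m.tmp = []) (body b) (fun m => F b m.word)) :
    Emits (AtPosition a) (forMarks a body)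
      (fun m => (marked m.left a m.right).flatMap fun b => F b m.word) := by
  obtain ⟨P, hP⟩ := Emits.exists_uniform h
  refine ⟨Polynomial.X * (P + Polynomial.C 8) + Polynomial.C 8, fun m rv ⟨hw, ht, hp, hm⟩ => ?_⟩
  -- The number of iterations is the length of the word, in which all time bounds are expressed.
  have hl : m.word.length = m.left.length + 1 + m.right.length := by
    rw [hw]; simp; omega
  have h1 := runsIn_buildMarks m rv m.left m.right a
  have h2 := runsIn_loop Stk.marks (b := body)
    (fun d r => { m with marks := r }.stacks
      ((d.reverse.flatMap fun b => F b m.word).reverse ++ rv)) (P.eval m.word.length)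
    (fun _ _ => rfl) (marked m.left a m.right) (fun d b r _ => by
      have := hP b { m with marks := r } ((d.reverse.flatMap fun b => F b m.word).reverse ++ rv) ht
      have e : Function.update ({ m with marks := b :: r }.stacks
          ((d.reverse.flatMap fun b => F b m.word).reverse ++ rv)) Stk.marks r =
          { m with marks := r }.stacks
            ((d.reverse.flatMap fun b => F b m.word).reverse ++ rv) := by
        funext k; cases k <;> rfl
      rw [e]
      simpa using this)
  have e1 : { m with tmp := [], preMarks := [], marks := [] } = m := by
    cases m; simp_all
  have e2 : { m with tmp := [], preMarks := [], marks := marked m.left a m.right } =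
      { m with marks := marked m.left a m.right } := by
    cases m; simp_all
  have e3 : { m with marks := [] } = m := by cases m; simp_all
  simp only [e1, e2] at h1
  simp only [e3, List.reverse_reverse] at h2
  refine (h1.seq h2).mono ?_
  simp only [length_marked, ← hl, Polynomial.eval_add, Polynomial.eval_mul, Polynomial.eval_X,
    Polynomial.eval_C]
  ring_nf
  omega

/-! ### Loops over the positions of the word -/

/-- Concatenation over the positions of a word: `G` is applied to the letters before the position
(from right to left), the letter at the position, and the letters after it. -/
def zipFlatMap {α β : Type*} (G : List α → α → List α → List β) : List α → List α → List β
  | _, [] => []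
  | l, a :: r => G l a r ++ zipFlatMap G (a :: l) r

/-- Copy the word to `right`. -/
def copyWord : Prog :=
  .seq (.loop .word fun a => .push .tmp a)
    (.loop .tmp fun a => .seq (.push .word a) (.push .right a))

/-- Run `body` for all positions of the word. -/
def forPositions (body : Letter → Prog) : Prog :=
  .seq copyWord (.seq (.loop .right fun a => .seq (body a) (.push .left a))
    (.loop .left fun _ => .skip))

theorem runsIn_copyWord (m : Mem) (rv : List InstanceSymbol) (w : List Letter) :
    RunsIn copyWord ({ m with word := w, right := [], tmp := [] }.stacks rv)
      ({ m with word := w, right := w, tmp := [] }.stacks rv) (w.length * 5 + 2) := by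
  have h1 := runsIn_loop Stk.word (b := fun a => (StackProg.push Stk.tmp a : Prog))
    (fun d r => { m with word := r, right := [], tmp := d }.stacks rv) 1 (fun _ _ => rfl) w
    fun _ a _ _ => runsIn_push .tmp a (by funext k; cases k <;> rfl)
  have h2 := runsIn_loop Stk.tmp (b := fun a => (StackProg.seq (.push Stk.word a)
    (.push Stk.right a) : Prog))
    (fun d r => { m with word := d, right := d, tmp := r }.stacks rv) 2 (fun _ _ => rfl) w.reverse
    fun d b r _ => RunsIn.seq (S' := { m with word := b :: d, right := d, tmp := r }.stacks rv)
      (runsIn_push .word b (by funext k; cases k <;> rfl))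
      (runsIn_push .right b (by funext k; cases k <;> rfl))
  rw [List.reverse_reverse] at h2
  refine (h1.seq h2).mono ?_
  simp; omega

/-- The recursion of `zipFlatMap` consumes the word from the left, whereas the loop invariant
extends the processed prefix at its right end. -/
theorem zipFlatMap_concat {α β : Type*} (a : α) :
    ∀ (G : List α → α → List α → List β) (d l : List α), zipFlatMap G l (d ++ [a]) =
      zipFlatMap (fun l b s => G l b (s ++ [a])) l d ++ G (d.reverse ++ l) a []
  | G, [], l => by simp [zipFlatMap]
  | G, b :: d, l => by
    simp [zipFlatMap, zipFlatMap_concat a G d (b :: l)]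

theorem emits_forPositions {body : Letter → Prog} {G : Letter → Mem → List InstanceSymbol}
    (h : ∀ a, Emits (AtPosition a) (body a) (G a)) :
    Emits (fun m => m.left = [] ∧ m.right = [] ∧ m.tmp = [] ∧ m.preMarks = [] ∧ m.marks = [])
      (forPositions body)
      (fun m => zipFlatMap (fun l a r => G a { m with left := l, right := r }) [] m.word) := by
  obtain ⟨P, hP⟩ := Emits.exists_uniform h
  refine ⟨Polynomial.X * (P + Polynomial.C 9) + Polynomial.C 4,
    fun m rv ⟨hl, hr, ht, hp, hm⟩ => ?_⟩
  set H := fun l a r => G a { m with left := l, right := r } with hH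
  have h1 := runsIn_copyWord m rv m.word
  -- Invariant: the text of all positions in the processed prefix `d.reverse` has been written,
  -- where each position sees the unprocessed letters `r` as the end of its right context.
  have h2 := runsIn_loop Stk.right (b := fun a => (StackProg.seq (body a) (.push .left a) : Prog))
    (fun d r => { m with left := d, right := r }.stacks
      ((zipFlatMap (fun l b s => H l b (s ++ r)) [] d.reverse).reverse ++ rv))
    (P.eval m.word.length + 1)
    (fun _ _ => rfl) m.word (fun d a r hd => by
      have e : Function.update ({ m with left := d, right := a :: r }.stacks
          ((zipFlatMap (fun l b s => H l b (s ++ a :: r)) [] d.reverse).reverse ++ rv))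
            Stk.right r = { m with left := d, right := r }.stacks
          ((zipFlatMap (fun l b s => H l b (s ++ a :: r)) [] d.reverse).reverse ++ rv) := by
        funext k; cases k <;> rfl
      rw [e]
      refine RunsIn.seq (hP a { m with left := d, right := r } _ ⟨hd.symm, ht, hp, hm⟩)
        (runsIn_push .left a ?_)
      rw [List.reverse_cons, zipFlatMap_concat]
      funext k
      cases k <;> simp [Mem.stacks, hH])
  have h3 := runsIn_loop Stk.left (b := fun _ => (.skip : Prog))
    (fun d r => { m with left := r, right := [] }.stacks
      ((zipFlatMap H [] m.word).reverse ++ rv)) 1 (fun _ _ => rfl) m.word.reverse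
    fun d a r _ => by
      have e : Function.update ({ m with left := a :: r, right := [] }.stacks
          ((zipFlatMap H [] m.word).reverse ++ rv)) Stk.left r =
            { m with left := r, right := [] }.stacks
          ((zipFlatMap H [] m.word).reverse ++ rv) := by
        funext k; cases k <;> rfl
      rw [e]
      exact RunsIn.skip _
  have e1 : { m with right := [], tmp := [] } = m := by cases m; simp_all
  have e2 : { m with right := m.word, tmp := [] } = { m with left := [], right := m.word } := by
    cases m; simp_all
  have e3 : { m with left := [], right := [] } = m := by cases m; simp_all
  simp only [e1, e2] at h1
  simp only [List.append_nil, List.reverse_reverse, List.reverse_nil, e3] at h2 h3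
  refine (h1.seq (h2.seq h3)).mono ?_
  simp only [List.length_reverse, Polynomial.eval_add, Polynomial.eval_mul, Polynomial.eval_X,
    Polynomial.eval_C]
  ring_nf
  omega

/-! ### Padding the input to a word of polynomial length -/

/-- A step pushes at most one symbol. Applied to the stack `rev`, this bounds the length of the text
by the time spent on writing it, and so the time for moving it to `out`. -/
theorem StackProg.Run.length_le {K : Type} {Γ : K → Type} [DecidableEq K] {p : StackProg K Γ}
    {S S' : ∀ k, List (Γ k)} {t : ℕ} (h : Run p S S' t) (k : K) :
    (S' k).length ≤ (S k).length + t := by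
  induction h with
  | skip S => omega
  | push k' a S =>
    by_cases hk : k = k'
    · subst hk; simp
    · simp [hk]
  | @pop k' b S S' t h ih =>
    by_cases hk : k = k'
    · subst hk
      rw [Function.update_self, List.length_tail] at ih
      omega
    · rw [Function.update_of_ne hk] at ih
      omega
  | loop_nil h => omega
  | @loop_cons k' b S a l S' S'' t t' h h1 h2 ih1 ih2 =>
    by_cases hk : k = k'
    · subst hk
      rw [Function.update_self] at ih1
      rw [h, List.length_cons]
      omega
    · rw [Function.update_of_ne hk] at ih1
      omega
  | seq h1 h2 ih1 ih2 => omega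

/-- The word with letters `x` and `n` blanks. -/
def paddedWord (x : List Bool) (n : ℕ) : List Letter :=
  (List.range (x.length + n)).map fun j => ⟨x[j]?, decide (j = 0), decide (j + 1 = x.length + n)⟩

/-- Multiply the number of symbols on `count` by the number of symbols on `base`. -/
def multiply : Prog :=
  .seq (.loop .count fun _ => .seq
      (.loop .base fun _ => .seq (.push .baseCopy ()) (.push .countCopy ()))
      (.loop .baseCopy fun _ => .push .base ()))
    (.loop .countCopy fun _ => .push .count ())

section

variable (m : Mem) (rv : List InstanceSymbol)

theorem runsIn_loop_skip (k : Stk) (S : ∀ k : Stk, List k.Sym) :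
    RunsIn (.loop k fun _ => .skip : Prog) S (Function.update S k []) ((S k).length * 2 + 1) := by
  have h := runsIn_loop k (b := fun _ => .skip)
    (fun _ r => Function.update S k r) 1 (fun d r => by simp) (S k)
    (fun d b r _ => by simpa using RunsIn.skip _)
  simpa using h

theorem runsIn_multiply (b n : ℕ) :
    RunsIn multiply
      ({ m with base := .replicate b (), baseCopy := [], count := .replicate n (),
                countCopy := [] }.stacks rv)
      ({ m with base := .replicate b (), baseCopy := [], count := .replicate (n * b) (),
                countCopy := [] }.stacks rv)
      (n * (5 * b + 3) + n * b * 2 + 2) := by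
  have h1 (c c' : List Unit) := runsIn_loop .base
    (b := fun _ => (.seq (.push .baseCopy ()) (.push .countCopy ()) : Prog))
    (fun d r => { m with base := r, baseCopy := d, count := c, countCopy := d ++ c' }.stacks rv)
    2 (fun _ _ => rfl) (.replicate b ()) (fun d u r _ =>
      RunsIn.seq (S' := { m with base := r, baseCopy := u :: d, count := c,
                                 countCopy := d ++ c' }.stacks rv)
        (runsIn_push .baseCopy () (by funext k; cases k <;> rfl))
        (runsIn_push .countCopy () (by funext k; cases k <;> rfl)))
  have h2 (c c' : List Unit) := runsIn_loop .baseCopy (b := fun _ => (.push .base () : Prog))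
    (fun d r => { m with base := d, baseCopy := r, count := c, countCopy := c' }.stacks rv)
    1 (fun _ _ => rfl) (.replicate b ()) (fun d u r _ =>
      runsIn_push .base () (by funext k; cases k <;> rfl))
  simp only [List.reverse_replicate, List.nil_append] at h1 h2
  have h3 := runsIn_loop .count (b := fun _ => (.seq
      (.loop .base fun _ => .seq (.push .baseCopy ()) (.push .countCopy ()))
      (.loop .baseCopy fun _ => .push .base ()) : Prog))
    (fun d r => { m with base := .replicate b (), baseCopy := [], count := r,
                         countCopy := .replicate (d.length * b) () }.stacks rv) (5 * b + 2)
    (fun _ _ => rfl) (.replicate n ()) (fun d u r _ => by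
      have e : Function.update
        ({ m with base := .replicate b (), baseCopy := [], count := u :: r, countCopy := .replicate (d.length * b) () }.stacks rv) .count r =
          { m with base := .replicate b (), baseCopy := [], count := r, countCopy := .replicate (d.length * b) () }.stacks rv := by
        funext k; cases k <;> rfl
      rw [e]
      have hA := h1 r (.replicate (d.length * b) ())
      rw [List.replicate_append_replicate,
        show b + d.length * b = (u :: d).length * b by
          rw [List.length_cons, Nat.add_one_mul, Nat.add_comm]] at hA
      exact (hA.seq (h2 r _)).mono (by simp; omega))
  have h4 := runsIn_loop .countCopy (b := fun _ => (.push .count () : Prog))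
    (fun d r => { m with base := .replicate b (), baseCopy := [], count := d,
                         countCopy := r }.stacks rv)
    1 (fun _ _ => rfl) (.replicate (n * b) ()) (fun d u r _ =>
      runsIn_push .count () (by funext k; cases k <;> rfl))
  simp only [List.reverse_replicate, List.length_replicate, List.length_nil, Nat.zero_mul,
    List.replicate_zero] at h3 h4
  exact (h3.seq h4).mono (by ring_nf; omega)

theorem runsIn_modifyHead (k : Stk) (f : k.Sym → k.Sym) (S : ∀ k : Stk, List k.Sym) :
    RunsIn (.pop k fun o => o.elim .skip fun a => .push k (f a) : Prog) S
      (Function.update S k ((S k).modifyHead f)) 2 := by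
  refine RunsIn.pop rfl ?_
  cases h : S k with
  | nil => simpa using RunsIn.skip _
  | cons a l => exact runsIn_push k (f a) (by simp)

end

theorem runsIn_power (d : ℕ) : ∃ P : Polynomial ℕ, ∀ (m : Mem) rv b,
    RunsIn (seqs (fun _ => multiply) (List.range d))
      ({ m with base := .replicate b (), baseCopy := [], count := [()], countCopy := [] }.stacks rv)
      ({ m with base := .replicate b (), baseCopy := [], count := .replicate (b ^ d) (),
                countCopy := [] }.stacks rv) (P.eval b) := by
  -- The first multiplication changes the initial value, so the exponent at the start has to be
  -- arbitrary; the single symbol on `count` is the case `e = 0`.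
  suffices H : ∀ l : List ℕ, ∀ e, ∃ P : Polynomial ℕ, ∀ (m : Mem) rv b,
      RunsIn (seqs (fun _ => multiply) l)
        ({ m with base := .replicate b (), baseCopy := [], count := .replicate (b ^ e) (),
                  countCopy := [] }.stacks rv)
        ({ m with base := .replicate b (), baseCopy := [], count := .replicate (b ^ (e + l.length)) (),
                  countCopy := [] }.stacks rv) (P.eval b) by
    simpa using H (List.range d) 0
  intro l
  induction l with
  | nil => exact fun e => ⟨1, fun m rv b => by simpa [seqs] using RunsIn.skip _⟩
  | cons i l ih =>
    intro e
    obtain ⟨P, hP⟩ := ih (e + 1)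
    refine ⟨.X ^ e * (.C 5 * .X + .C 3) + .X ^ e * .X * .C 2 + .C 2 + P, fun m rv b => ?_⟩
    have h1 := runsIn_multiply m rv b (b ^ e)
    rw [← pow_succ] at h1
    have h := h1.seq (hP m rv b)
    rw [show e + (i :: l).length = e + 1 + l.length by simp; omega]
    refine h.mono ?_
    simp only [Polynomial.eval_add, Polynomial.eval_mul, Polynomial.eval_X, Polynomial.eval_C,
      Polynomial.eval_pow]
    rw [← pow_succ]

/-- Prepare the padded word on the stack `word`. -/
def makeWord (c d : ℕ) : Prog :=
  .seq (.loop .inp fun a => .seq (.push .tmp ⟨some a, false, false⟩) (.push .base ()))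
  (.seq (seqs (fun _ => .push .base ()) (List.range c))
  (.seq (.push .count ())
  (.seq (seqs (fun _ => multiply) (List.range d))
  (.seq (.loop .count fun _ => .push .tmp ⟨none, false, false⟩)
  (.seq (.loop .base fun _ => .skip)
  (.seq (.pop .tmp fun o => o.elim .skip fun a => .push .tmp { a with last := true })
  (.seq restoreWord
  (.pop .word fun o => o.elim .skip fun a => .push .word { a with first := true }))))))))

theorem runsIn_pushBase (m : Mem) (rv : List InstanceSymbol) : ∀ (l : List ℕ) (n : ℕ),
    RunsIn (seqs (fun _ => .push .base ()) l : Prog) ({ m with base := .replicate n () }.stacks rv)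
      ({ m with base := .replicate (n + l.length) () }.stacks rv) (l.length + 1)
  | [], n => RunsIn.skip _
  | i :: l, n => by
    have h := (runsIn_push .base () (S := { m with base := .replicate n () }.stacks rv)
      (S' := { m with base := .replicate (n + 1) () }.stacks rv)
      (by funext k; cases k <;> rfl)).seq (runsIn_pushBase m rv l (n + 1))
    rw [show n + (i :: l).length = n + 1 + l.length by simp; omega]
    exact h.mono (by simp; omega)

/-- The list is the padded word read backwards, without its end labels: index `i` from the top
corresponds to position `j` of the word. -/
theorem getElem_replicate_append_reverse (x : List Bool) (n i j : ℕ)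
    (h : i < (List.replicate n (⟨none, false, false⟩ : Letter) ++
      (x.map fun a => (⟨some a, false, false⟩ : Letter)).reverse).length)
    (hj : i + j + 1 = x.length + n) :
    (List.replicate n (⟨none, false, false⟩ : Letter) ++
      (x.map fun a => (⟨some a, false, false⟩ : Letter)).reverse)[i] = ⟨x[j]?, false, false⟩ := by
  by_cases hi : i < n
  · rw [List.getElem_append_left (by simpa using hi), List.getElem_replicate,
      List.getElem?_eq_none (by omega)]
  · rw [List.getElem_append_right (by simpa using hi), List.getElem_reverse, List.getElem_map,
      List.getElem?_eq_getElem (by omega)]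
    simp only [List.length_map, List.length_replicate]
    congr 3
    omega

/-- The right side is what `makeWord` produces. The input arrives reversed on `tmp` and the blanks
come on top, so the top is then the last letter; after the word has been moved back, the top is the
first letter. -/
theorem paddedWord_eq (x : List Bool) (n : ℕ) :
    paddedWord x n =
      (((List.replicate n (⟨none, false, false⟩ : Letter) ++
        (x.map fun a => (⟨some a, false, false⟩ : Letter)).reverse).modifyHead
          fun a => { a with last := true }).reverse).modifyHead fun a =>
            { a with first := true } := by
  have key := getElem_replicate_append_reverse x n
  have hA : (List.replicate n (⟨none, false, false⟩ : Letter) ++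
      (x.map fun a => (⟨some a, false, false⟩ : Letter)).reverse).length = x.length + n := by
    simp; omega
  generalize (List.replicate n (⟨none, false, false⟩ : Letter) ++
      (x.map fun a => (⟨some a, false, false⟩ : Letter)).reverse) = A at key hA ⊢
  refine List.ext_getElem (by simp [paddedWord, hA]) fun j h1 h2 => ?_
  simp only [paddedWord, List.length_map, List.length_range] at h1
  simp only [List.getElem_modifyHead, List.getElem_reverse, List.length_modifyHead, hA]
  simp only [paddedWord, List.getElem_map, List.getElem_range]
  split_ifs with hj h3 h3
  · subst hj
    rw [key 0 0 _ (by omega)]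
    simp; omega
  · subst hj
    rw [key _ 0 _ (by omega)]
    simp; omega
  · rw [key 0 j _ (by omega)]
    simp [hj]; omega
  · rw [key _ j _ (by omega)]
    simp [hj]; omega

theorem runsIn_makeWord (c d : ℕ) : ∃ P : Polynomial ℕ, ∀ x : List Bool,
    RunsIn (makeWord c d) (({ inp := x } : Mem).stacks [])
      (({ word := paddedWord x ((x.length + c) ^ d) } : Mem).stacks []) (P.eval x.length) := by
  obtain ⟨P, hP⟩ := runsIn_power d
  refine ⟨.X * .C 12 + .C (3 * c + 30) + (P.comp (.X + .C c)) + (.X + .C c) ^ d * .C 4, fun x => ?_⟩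
  set b := x.length + c with hb
  let L (s : Option Bool) : Letter := ⟨s, false, false⟩
  have h1 := runsIn_loop .inp
    (b := fun a => (.seq (.push .tmp (L (some a))) (.push .base ()) : Prog))
    (fun d r =>
      ({ inp := r, tmp := d.map fun a => L (some a), base := .replicate d.length () } : Mem).stacks []) 2
    (fun _ _ => rfl) x (fun d a r _ =>
      RunsIn.seq (S' :=
        ({ inp := r, tmp := (a :: d).map fun a => L (some a), base := .replicate d.length () } : Mem).stacks [])
        (runsIn_push .tmp (L (some a)) (by funext k; cases k <;> rfl))
        (runsIn_push .base () (by funext k; cases k <;> rfl)))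
  set t₁ := x.reverse.map fun a => L (some a) with ht₁
  have h2 := runsIn_pushBase { tmp := t₁ } [] (List.range c) x.length
  have h3 := runsIn_push .count ()
    (S := ({ tmp := t₁, base := .replicate b () } : Mem).stacks [])
    (S' := ({ tmp := t₁, base := .replicate b (), count := [()] } : Mem).stacks [])
    (by funext k; cases k <;> rfl)
  have h4 := hP { tmp := t₁ } [] b
  have h5 := runsIn_loop .count (b := fun _ => (.push .tmp (L none) : Prog))
    (fun d r =>
      ({ base := .replicate b (), count := r, tmp := .replicate d.length (L none) ++ t₁ } : Mem).stacks []) 1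
    (fun _ _ => rfl) (.replicate (b ^ d) ()) (fun d a r _ =>
      runsIn_push .tmp (L none) (by funext k; cases k <;> rfl))
  set t₂ := List.replicate (b ^ d) (L none) ++ t₁ with ht₂
  have h6 := runsIn_loop_skip .base (({ base := .replicate b (), tmp := t₂ } : Mem).stacks [])
  have h7 := runsIn_modifyHead .tmp (fun a => { a with last := true })
    (({ tmp := t₂ } : Mem).stacks [])
  have h8 := runsIn_restoreWord {} [] (t₂.modifyHead fun a => { a with last := true }) []
  have h9 := runsIn_modifyHead .word (fun a => { a with first := true })
    (({ word := (t₂.modifyHead fun a => { a with last := true }).reverse } : Mem).stacks [])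
  have e6 : Function.update (({ base := .replicate b (), tmp := t₂ } : Mem).stacks []) .base [] =
      ({ tmp := t₂ } : Mem).stacks [] := by
    funext k; cases k <;> rfl
  have e7 : Function.update (({ tmp := t₂ } : Mem).stacks []) .tmp
      ((({ tmp := t₂ } : Mem).stacks [] .tmp).modifyHead fun a => { a with last := true }) =
      ({ tmp := t₂.modifyHead fun a => { a with last := true } } : Mem).stacks [] := by
    funext k; cases k <;> rfl
  have e9 : Function.update
      (({ word := (t₂.modifyHead fun a => { a with last := true }).reverse } : Mem).stacks []) .word
      (((({ word := (t₂.modifyHead fun a => { a with last := true }).reverse } : Mem).stacks [])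
        .word).modifyHead fun a => { a with first := true }) =
      ({ word := paddedWord x (b ^ d) } : Mem).stacks [] := by
    rw [paddedWord_eq, ← List.map_reverse]
    funext k; cases k <;> rfl
  rw [e6] at h6
  rw [e7] at h7
  rw [e9] at h9
  simp only [List.append_nil] at h8
  simp only [List.length_range, ← hb] at h2
  simp only [List.length_reverse] at h1
  simp only [List.reverse_replicate, List.length_replicate] at h5
  refine (h1.seq (h2.seq (h3.seq (h4.seq (h5.seq (h6.seq (h7.seq (h8.seq h9)))))))).mono ?_
  have hl : t₂.length = b ^ d + x.length := by simp [ht₂, ht₁]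
  simp only [Mem.stacks, List.length_modifyHead, hl, List.length_replicate, Polynomial.eval_add,
    Polynomial.eval_mul, Polynomial.eval_X, Polynomial.eval_C, Polynomial.eval_comp,
    Polynomial.eval_pow, ← hb]
  omega

/-- A function is computable in polynomial time if its values are written by a program that works
on the padded word. -/
theorem Emits.nonempty_tm2ComputableInPolyTime {p : Prog} {F : Mem → List InstanceSymbol}
    (h : Emits (fun m => m.left = [] ∧ m.right = [] ∧ m.tmp = [] ∧ m.preMarks = [] ∧ m.marks = [])
      p F) (c d : ℕ) :
    Nonempty (Turing.TM2ComputableInPolyTime (id : List Bool → _) (id : List InstanceSymbol → _)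
      fun x => F { word := paddedWord x ((x.length + c) ^ d) }) := by
  obtain ⟨P, hP⟩ := runsIn_makeWord c d
  obtain ⟨Q, hQ⟩ := h
  let R : Polynomial ℕ := .X + (.X + .C c) ^ d
  have hR : ∀ x : List Bool, (paddedWord x ((x.length + c) ^ d)).length = R.eval x.length := by
    intro x; simp [paddedWord, R]
  refine StackProg.nonempty_tm2ComputableInPolyTime (K := Stk) (Γ := Stk.Sym)
    (.seq (makeWord c d) (.seq p (.seq (.loop .word fun _ => .skip)
      (.loop .rev fun a => .push .out a)))) .inp .out _
    (P + Q.comp R + R * .C 2 + (Q.comp R) * .C 2 + .C 2) fun x => ?_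
  set w := paddedWord x ((x.length + c) ^ d) with hw
  have h1 := hP x
  have h2 := hQ { word := w } [] ⟨rfl, rfl, rfl, rfl, rfl⟩
  -- The text has been written in reverse on `rev`. Moving it to `out` costs time linear in its
  -- length, which the writing time bounds.
  have hlen : (F { word := w }).length ≤ Q.eval w.length := by
    obtain ⟨t, ht, h2⟩ := h2
    change t ≤ Q.eval w.length at ht
    have := h2.length_le .rev
    simp only [Mem.stacks, List.append_nil, List.length_reverse, List.length_nil] at this
    omega
  have h3 := runsIn_loop_skip .word (({ word := w } : Mem).stacks ((F { word := w }).reverse))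
  have h4 := runsIn_loop .rev (b := fun a => (.push .out a : Prog))
    (fun d r => ({ out := d } : Mem).stacks r) 1 (fun _ _ => rfl) (F { word := w }).reverse
    (fun d a r _ => runsIn_push .out a (by funext k; cases k <;> rfl))
  have e3 : Function.update (({ word := w } : Mem).stacks ((F { word := w }).reverse)) .word [] =
      ({} : Mem).stacks ((F { word := w }).reverse) := by
    funext k; cases k <;> rfl
  have e0 : (Function.update (fun _ => []) Stk.inp x : ∀ k : Stk, List k.Sym) =
      ({ inp := x } : Mem).stacks [] := by
    funext k; cases k <;> rfl
  have e5 : (Function.update (fun _ => []) Stk.out (F { word := w }) : ∀ k : Stk, List k.Sym) =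
      ({ out := F { word := w } } : Mem).stacks [] := by
    funext k; cases k <;> rfl
  rw [e3] at h3
  simp only [List.append_nil, List.reverse_reverse] at h2 h4
  erw [e0, e5]
  refine (h1.seq (h2.seq (h3.seq h4))).mono ?_
  simp only [Mem.stacks, List.length_reverse, hR, hw, Polynomial.eval_add, Polynomial.eval_mul,
    Polynomial.eval_C, Polynomial.eval_comp] at hlen ⊢
  omega

/-! ### Membership in a sink equilibrium -/

namespace StrategicGame

/-- A component without outgoing arcs contains everything reachable from its members. Conversely, if
all reachable states lead back to `S`, the component of `S` itself has no outgoing arc. -/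
theorem inASink_iff {N : Type} [DecidableEq N] (G : StrategicGame N) (S : G.State) :
    G.InASink S ↔ ∀ S', G.Reachable S S' → G.Reachable S' S := by
  constructor
  · rintro ⟨T, ⟨⟨S₀, rfl⟩, hT⟩, hS⟩ S' hS'
    have : S' ∈ {S' | G.Reachable S₀ S' ∧ G.Reachable S' S₀} := by
      induction hS' with
      | refl => exact hS
      | tail _ h ih => exact hT _ ih _ h
    exact this.2.trans hS.1
  · intro h
    refine ⟨{S' | G.Reachable S S' ∧ G.Reachable S' S}, ⟨⟨S, rfl⟩, ?_⟩, .refl, .refl⟩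
    rintro S₁ ⟨h1, h2⟩ S₂ h3
    exact ⟨h1.tail h3, h _ (h1.tail h3)⟩

end StrategicGame

/-! ### Games given by incidences between strategies and resources -/

/-- A player-specific congestion game with named strategies: `inc i t e` says that the strategy `t`
of player `i` contains the resource `e`. -/
structure IncidenceGame where
  N : Type
  E : Type
  T : N → Type
  [decN : DecidableEq N]
  [fintypeN : Fintype N]
  [fintypeE : Fintype E]
  players : List N
  nodup_players : players.Nodup
  mem_players : ∀ i, i ∈ players
  resources : List E
  nodup_resources : resources.Nodup
  mem_resources : ∀ e, e ∈ resources
  strategies : (i : N) → List (T i)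
  mem_strategies : ∀ i t, t ∈ strategies i
  inc : (i : N) → T i → E → Bool
  delay : N → E → ℕ → ℤ
  profile : (i : N) → T i

namespace IncidenceGame

variable (A : IncidenceGame)

instance : DecidableEq A.N := A.decN
instance : Fintype A.N := A.fintypeN
instance : Fintype A.E := A.fintypeE

/-- The set of resources of a strategy. -/
def strategySet (i : A.N) (t : A.T i) : Finset (Fin A.resources.length) :=
  Finset.univ.filter fun e => A.inc i t (A.resources.get e)

/-- The instance that describes the game. -/
def toInstance : InASinkInstance where
  n := A.players.length
  m := A.resources.length
  strategyList i := (A.strategies (A.players.get i)).map (A.strategySet _)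
  delayTable e i k := A.delay (A.players.get i) (A.resources.get e) (k + 1)
  profile i := A.strategySet _ (A.profile (A.players.get i))
  profile_mem i := List.mem_map_of_mem (A.mem_strategies _ _)

/-- The cost of a player. -/
def cost (X : (i : A.N) → A.T i) (i : A.N) : ℤ :=
  ∑ e ∈ Finset.univ.filter fun e => A.inc i (X i) e,
    A.delay i e (Finset.univ.filter fun j => A.inc j (X j) e).card

/-- Improving moves of a single player. -/
def Move (X Y : (i : A.N) → A.T i) : Prop :=
  ∃ i t, Y = Function.update X i t ∧ A.cost Y i < A.cost X i

/-- The players of the instance. -/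
def playerEquiv : Fin A.players.length ≃ A.N where
  toFun i := A.players.get i
  invFun i := ⟨A.players.idxOf i, List.idxOf_lt_length_iff.2 (A.mem_players i)⟩
  left_inv i := by
    ext
    exact A.nodup_players.idxOf_getElem _ i.2
  right_inv i := by simp

/-- The resources of the instance. -/
noncomputable def resourceEquiv : Fin A.resources.length ≃ A.E :=
  Equiv.ofBijective A.resources.get
    ⟨List.nodup_iff_injective_get.1 A.nodup_resources,
      fun e => List.mem_iff_get.1 (A.mem_resources e)⟩

/-- The state of the instance given by named strategies. -/
def toState (X : (i : A.N) → A.T i) : A.toInstance.game.toStrategicGame.State :=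
  fun i => ⟨A.strategySet _ (X (A.players.get i)),
    List.mem_toFinset.2 (List.mem_map_of_mem (A.mem_strategies _ _))⟩

theorem toState_profile : A.toState A.profile = A.toInstance.state := rfl

theorem mem_toState (X : (i : A.N) → A.T i) (i : Fin A.toInstance.n) (e : Fin A.toInstance.m) :
    e ∈ (A.toState X i).1 ↔ A.inc (A.players.get i) (X (A.players.get i)) (A.resources.get e) := by
  simp only [toState, strategySet]
  exact ⟨fun h => (Finset.mem_filter.1 h).2, fun h => Finset.mem_filter.2 ⟨Finset.mem_univ _, h⟩⟩

theorem congestion_toState (X : (i : A.N) → A.T i) (e : Fin A.toInstance.m) :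
    A.toInstance.game.congestion (A.toState X) e =
      (Finset.univ.filter fun j => A.inc j (X j) (A.resources.get e)).card := by
  refine Finset.card_bij (fun i _ => A.players.get i) ?_ ?_ ?_
  · intro i hi
    rw [Finset.mem_filter] at hi
    exact Finset.mem_filter.2 ⟨Finset.mem_univ _, (A.mem_toState X i e).1 hi.2⟩
  · intro i _ j _ h
    exact A.playerEquiv.injective h
  · intro j hj
    obtain ⟨i, rfl⟩ := A.playerEquiv.surjective j
    exact ⟨i, Finset.mem_filter.2 ⟨Finset.mem_univ _,
      (A.mem_toState X i e).2 (Finset.mem_filter.1 hj).2⟩, rfl⟩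

theorem cost_toState (X : (i : A.N) → A.T i) (i : Fin A.players.length) :
    A.toInstance.game.cost (A.toState X) i = A.cost X (A.players.get i) := by
  unfold PlayerSpecificCongestionGame.cost cost
  refine Finset.sum_bij (fun e _ => A.resources.get e) ?_ ?_ ?_ ?_
  · intro e he
    exact Finset.mem_filter.2 ⟨Finset.mem_univ _, (A.mem_toState X i e).1 he⟩
  · intro e _ e' _ h
    exact A.resourceEquiv.injective h
  · intro e he
    obtain ⟨e', rfl⟩ := A.resourceEquiv.surjective e
    exact ⟨e', (A.mem_toState X i e').2 (Finset.mem_filter.1 he).2, rfl⟩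
  · intro e he
    rw [congestion_toState]
    -- The player itself uses `e`, so the congestion lies between 1 and the number of players and
    -- the value comes from the table, not from the default 0.
    have h1 : 1 ≤ (Finset.univ.filter fun j => A.inc j (X j) (A.resources.get e)).card := by
      refine Finset.card_pos.2 ⟨A.players.get i, ?_⟩
      exact Finset.mem_filter.2 ⟨Finset.mem_univ _, (A.mem_toState X i e).1 he⟩
    have h2 : (Finset.univ.filter fun j => A.inc j (X j) (A.resources.get e)).card ≤
        A.players.length := by
      rw [← A.congestion_toState]
      exact (Finset.card_le_univ _).trans (Fintype.card_fin _).le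
    simp only [InASinkInstance.game, toInstance]
    refine (dif_pos ⟨h1, h2⟩).trans ?_
    congr 1
    exact Nat.sub_add_cancel h1

theorem toState_update (X : (i : A.N) → A.T i) (i : Fin A.toInstance.n)
    (t : A.T (A.players.get i)) :
    A.toState (Function.update X (A.players.get i) t) =
      Function.update (A.toState X) i (⟨A.strategySet _ t,
        List.mem_toFinset.2 (List.mem_map_of_mem (A.mem_strategies _ _))⟩) := by
  funext j
  by_cases hj : j = i
  · subst hj
    apply Subtype.ext
    simp [toState, Function.update]
    rfl
  · have : A.players.get j ≠ A.players.get i := fun h => hj (A.playerEquiv.injective h)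
    refine Eq.trans ?_ (Function.update_of_ne hj _ _).symm
    exact Subtype.ext (congrArg (A.strategySet _) (Function.update_of_ne this _ _))

theorem arc_toState_iff (X : (i : A.N) → A.T i) (S' : A.toInstance.game.toStrategicGame.State) :
    A.toInstance.game.toStrategicGame.Arc (A.toState X) S' ↔ ∃ Y,
      S' = A.toState Y ∧ A.Move X Y := by
  constructor
  · rintro ⟨i, ⟨s, hs⟩, rfl, h⟩
    obtain ⟨t, -, rfl⟩ := List.mem_map.1 (List.mem_toFinset.1 hs)
    refine ⟨Function.update X (A.players.get i) t, (A.toState_update X i t).symm, _, t, rfl, ?_⟩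
    have e := A.toState_update X i t
    change -((A.toInstance.game.cost _ i : ℤ) : ℝ) < -((A.toInstance.game.cost _ i : ℤ) : ℝ) at h
    erw [← e] at h
    rw [neg_lt_neg_iff, Int.cast_lt] at h
    exact (A.cost_toState _ i).symm.trans_lt (h.trans_eq (A.cost_toState X i))
  · rintro ⟨Y, rfl, i, t, rfl, h⟩
    obtain ⟨i, rfl⟩ := A.playerEquiv.surjective i
    refine ⟨i, _, A.toState_update X i t, ?_⟩
    change -((A.toInstance.game.cost _ i : ℤ) : ℝ) < -((A.toInstance.game.cost _ i : ℤ) : ℝ)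
    rw [neg_lt_neg_iff, Int.cast_lt]
    exact (A.cost_toState _ i).trans_lt (h.trans_eq (A.cost_toState X i).symm)

/-- Arcs between sets of resources always lift to moves between named strategies, but a walk back to
the given state lifts only to a walk into some profile with the same sets. By `hinj` this profile is
the original one. -/
theorem isYes_toInstance_iff (hinj : ∀ i t t', A.inc i t = A.inc i t' → t = t') :
    A.toInstance.IsYes ↔ ∀ Y, Relation.ReflTransGen A.Move A.profile Y →
      Relation.ReflTransGen A.Move Y A.profile := by
  have hto : ∀ {X Y}, Relation.ReflTransGen A.Move X Y →
      A.toInstance.game.toStrategicGame.Reachable (A.toState X) (A.toState Y) := by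
    intro X Y h
    exact h.lift A.toState fun X Y h => (A.arc_toState_iff X _).2 ⟨Y, rfl, h⟩
  have hfrom : ∀ {X S'}, A.toInstance.game.toStrategicGame.Reachable (A.toState X) S' →
      ∃ Y, S' = A.toState Y ∧ Relation.ReflTransGen A.Move X Y := by
    intro X S' h
    induction h with
    | refl => exact ⟨X, rfl, .refl⟩
    | tail _ h ih =>
      obtain ⟨Y, rfl, hY⟩ := ih
      obtain ⟨Z, rfl, hZ⟩ := (A.arc_toState_iff Y _).1 h
      exact ⟨Z, rfl, hY.tail hZ⟩
  have htoinj : Function.Injective A.toState := by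
    intro X Y h
    funext i
    obtain ⟨i, rfl⟩ := A.playerEquiv.surjective i
    refine hinj _ _ _ (funext fun e => ?_)
    obtain ⟨e, rfl⟩ := A.resourceEquiv.surjective e
    have h1 := Finset.ext_iff.1 (congrArg Subtype.val (congrFun h i)) e
    erw [A.mem_toState X i e, A.mem_toState Y i e] at h1
    exact Bool.eq_iff_iff.2 h1
  unfold InASinkInstance.IsYes
  rw [StrategicGame.inASink_iff, ← toState_profile]
  constructor
  · intro h Y hY
    obtain ⟨Z, hZ, hYZ⟩ := hfrom (h _ (hto hY))
    rwa [htoinj hZ]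
  · intro h S' hS'
    obtain ⟨Y, rfl, hY⟩ := hfrom hS'
    exact hto (h Y hY)

open InASinkInstance InstanceSymbol in
/-- The description of the game. -/
theorem encode_toInstance : A.toInstance.encode =
    List.replicate A.players.length tick ++ [semicolon] ++
    (List.replicate A.resources.length tick ++ [semicolon] ++
    (A.players.flatMap (fun i => (A.strategies i).flatMap (fun t =>
      A.resources.map (fun e => bit (A.inc i t e)) ++ [comma]) ++ [semicolon]) ++
    (A.players.flatMap (fun i =>
      A.resources.map (fun e => bit (A.inc i (A.profile i) e)) ++ [comma]) ++
    A.resources.flatMap (fun e => A.players.flatMap (fun i =>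
      (List.range A.players.length).flatMap fun k => encodeInt (A.delay i e (k + 1))))))) := by
  have hset : ∀ i (t : A.T i), encodeSet (A.strategySet i t) =
      A.resources.map (fun e => bit (A.inc i t e)) ++ [comma] := by
    intro i t
    simp only [encodeSet, strategySet]
    congr 1
    conv_rhs => rw [← List.map_get_finRange A.resources, List.map_map]
    refine List.map_congr_left fun e _ => ?_
    simp
  have hflat : ∀ {α : Type} (l : List α) (f : α → List InstanceSymbol),
      (List.finRange l.length).flatMap (fun i => f (l.get i)) = l.flatMap f := by
    intro α l f
    conv_rhs => rw [← List.map_get_finRange l, List.flatMap_map]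
  have hrange : ∀ (n : ℕ) (f : ℕ → List InstanceSymbol),
      (List.finRange n).flatMap (fun k : Fin n => f k) = (List.range n).flatMap f := by
    intro n f
    rw [← List.map_coe_finRange_eq_range, List.flatMap_map]
  unfold encode encodeUnary encodeStrategies
  simp only [toInstance]
  rw [← hflat A.players, ← hflat A.players, ← hflat A.resources]
  simp only [hset, ← hflat A.players, List.flatMap_map, ← hrange]

end IncidenceGame

/-! ### The game that simulates a machine -/

/-- The players: the control, its shadow, and the cells. -/
inductive Player (Pos : Type) where
  | ctrl
  | shadow
  | cell (i : Pos)
  deriving DecidableEq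

/-- The resources that belong to a position: for control contents `CC` and symbols `Γ`. -/
inductive Res (CC Γ : Type) where
  | copy (c : CC)
  | write (g : Γ)
  | goto (c : CC) (g : Γ)
  deriving DecidableEq

/-- The strategies of the players. -/
@[reducible]
def Player.Strategy (Pos CC Γ : Type) : Player Pos → Type
  | .ctrl => Pos × CC
  | .shadow => Pos × CC
  | .cell _ => Γ

namespace ControlGame

variable {Pos CC Γ : Type} [DecidableEq Pos] [DecidableEq CC] [DecidableEq Γ]

/-- The incidences: the control moves from `t` to `t'` when `go t g t'`, where `g` is the symbol at
the position of `t`, and symbol `g` is written there when `wr t g`. -/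
def inc (go : Pos × CC → Γ → Pos × CC → Bool) (wr : Pos × CC → Γ → Bool) :
    (i : Player Pos) → i.Strategy Pos CC Γ → Pos × Res CC Γ → Bool
  | .ctrl, t, (j, .copy c) => decide (t = (j, c))
  | .ctrl, _, (_, .write _) => false
  | .ctrl, t, (j, .goto c g) => go (j, c) g t
  | .shadow, t, (j, .copy c) => decide (t = (j, c))
  | .shadow, t, (j, .write g) => decide (t.1 = j) && wr t g
  | .shadow, t, (j, .goto c _) => decide (t = (j, c))
  | .cell _, _, (_, .copy _) => false
  | .cell i, b, (j, .write g) => decide (i = j) && decide (b = g)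
  | .cell i, b, (j, .goto _ g) => decide (i = j) && decide (b = g)

/-- The delays. -/
def delay : Player Pos → Pos × Res CC Γ → ℕ → ℤ
  | .ctrl, (_, .goto _ _), k => if 3 ≤ k then -1 else 0
  | .shadow, (_, .copy _), k => if 2 ≤ k then -1 else 0
  | .cell i, (j, .write _), k => if i = j ∧ 2 ≤ k then -1 else 0
  | _, _, _ => 0

theorem inc_injective (go : Pos × CC → Γ → Pos × CC → Bool) (wr : Pos × CC → Γ → Bool)
    (i : Player Pos) (t t' : i.Strategy Pos CC Γ) (h : inc go wr i t = inc go wr i t') :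
    t = t' := by
  cases i with
  | ctrl => simpa [inc, eq_comm] using congrFun h (t.1, .copy t.2)
  | shadow => simpa [inc, eq_comm] using congrFun h (t.1, .copy t.2)
  | cell i => simpa [inc, eq_comm] using congrFun h (i, .write t)

/-- The strategies of all players, from those of the control, its shadow, and the cells. -/
def config (C D : Pos × CC) (x : Pos → Γ) : (i : Player Pos) → i.Strategy Pos CC Γ
  | .ctrl => C
  | .shadow => D
  | .cell i => x i

theorem eq_config (X : (i : Player Pos) → i.Strategy Pos CC Γ) :
    X = config (X .ctrl) (X .shadow) fun i => X (.cell i) := by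
  funext i; cases i <;> rfl

theorem update_ctrl (C D t : Pos × CC) (x : Pos → Γ) :
    Function.update (config C D x) .ctrl t = config t D x := by
  funext i; cases i <;> simp [config, Function.update]

theorem update_shadow (C D t : Pos × CC) (x : Pos → Γ) :
    Function.update (config C D x) .shadow t = config C t x := by
  funext i; cases i <;> simp [config, Function.update]

theorem update_cell (C D : Pos × CC) (x : Pos → Γ) (i : Pos) (b : Γ) :
    Function.update (config C D x) (.cell i) b = config C D (Function.update x i b) := by
  funext j
  cases j with
  | ctrl => simp [config, Function.update]
  | shadow => simp [config, Function.update]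
  | cell j =>
    by_cases h : j = i
    · subst h; simp [config]
    · have h' : (Player.cell j) ≠ .cell i := by simpa using h
      rw [Function.update_of_ne h']
      simp [config, h]

variable [Fintype (Player Pos)] [Fintype (Pos × Res CC Γ)]
  (go : Pos × CC → Γ → Pos × CC → Bool) (wr : Pos × CC → Γ → Bool)

/-- The number of players that use a resource. -/
def load (X : (i : Player Pos) → i.Strategy Pos CC Γ) (e : Pos × Res CC Γ) : ℕ :=
  (Finset.univ.filter fun j => inc go wr j (X j) e).card

/-- The cost of a player. -/
def cost (X : (i : Player Pos) → i.Strategy Pos CC Γ) (i : Player Pos) : ℤ :=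
  ∑ e ∈ Finset.univ.filter fun e => inc go wr i (X i) e, delay i e (load go wr X e)

/-- This makes a resource a conjunction: if only players in `A` can use it, its load reaches the
size of `A` exactly when all of them do. The delays have their thresholds 2 and 3 at these sizes. -/
theorem card_le_load_iff {X : (i : Player Pos) → i.Strategy Pos CC Γ} {e : Pos × Res CC Γ}
    {A : Finset (Player Pos)} (hA : ∀ i, inc go wr i (X i) e → i ∈ A) :
    A.card ≤ load go wr X e ↔ ∀ i ∈ A, inc go wr i (X i) e := by
  have hsub : (Finset.univ.filter fun j => inc go wr j (X j) e) ⊆ A := fun i hi =>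
    hA i (Finset.mem_filter.1 hi).2
  constructor
  · intro h i hi
    rw [← Finset.eq_of_subset_of_card_le hsub h] at hi
    exact (Finset.mem_filter.1 hi).2
  · intro h
    exact Finset.card_le_card fun i hi => Finset.mem_filter.2 ⟨Finset.mem_univ _, h i hi⟩

theorem two_le_load_copy (C D : Pos × CC) (x : Pos → Γ) (j : Pos) (c : CC) :
    2 ≤ load go wr (config C D x) (j, .copy c) ↔ C = (j, c) ∧ D = (j, c) := by
  have := card_le_load_iff go wr (X := config C D x) (e := (j, .copy c)) (A := {.ctrl, .shadow})
    (fun i => by cases i <;> simp [inc])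
  rw [Finset.card_pair (by simp)] at this
  rw [this]
  simp [inc, config]

theorem two_le_load_write (C D : Pos × CC) (x : Pos → Γ) (j : Pos) (g : Γ) :
    2 ≤ load go wr (config C D x) (j, .write g) ↔ (D.1 = j ∧ wr D g) ∧ x j = g := by
  have := card_le_load_iff go wr (X := config C D x) (e := (j, .write g)) (A := {.shadow, .cell j})
    (fun i => by cases i <;> simp +contextual [inc])
  rw [Finset.card_pair (by simp)] at this
  rw [this]
  simp [inc, config]

theorem three_le_load_goto (C D : Pos × CC) (x : Pos → Γ) (j : Pos) (c : CC) (g : Γ) :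
    3 ≤ load go wr (config C D x) (j, .goto c g) ↔ go (j, c) g C ∧ D = (j, c) ∧ x j = g := by
  have := card_le_load_iff go wr (X := config C D x) (e := (j, .goto c g))
    (A := {.ctrl, .shadow, .cell j}) (fun i => by cases i <;> simp +contextual [inc])
  rw [Finset.card_insert_of_notMem (by simp), Finset.card_pair (by simp)] at this
  rw [this]
  simp [inc, config]

/-- In each cost at most one resource contributes, namely the one naming the actual strategies of
the players concerned. -/
theorem sum_eq_ite {E : Type} [Fintype E] [DecidableEq E] (S : Finset E) (f : E → ℤ) (e₀ : E)
    (P : Prop) [Decidable P] (h : ∀ e ∈ S, f e = if e = e₀ ∧ P then -1 else 0) (h₀ : P → e₀ ∈ S) :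
    ∑ e ∈ S, f e = if P then -1 else 0 := by
  rw [Finset.sum_congr rfl h]
  by_cases hP : P
  · simp [hP, h₀ hP]
  · simp [hP]

/-- The control is judged against the strategy of the shadow, which its own move leaves unchanged.
The shadow thus serves as a memory of the previous control, and the control stays put until the
shadow has caught up or the symbol has changed. -/
theorem cost_ctrl (C D : Pos × CC) (x : Pos → Γ) :
    cost go wr (config C D x) .ctrl = if go D (x D.1) C then -1 else 0 := by
  refine sum_eq_ite _ _ (D.1, .goto D.2 (x D.1)) _ ?_ ?_
  · rintro ⟨j, c | g | ⟨c, g⟩⟩ he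
    · simp [delay]
    · simp [delay]
    · simp only [delay, three_le_load_goto]
      refine if_congr ?_ rfl rfl
      obtain ⟨d, c'⟩ := D
      simp only [Prod.mk.injEq, Res.goto.injEq]
      constructor
      · rintro ⟨h, ⟨rfl, rfl⟩, rfl⟩; simp [h]
      · rintro ⟨⟨rfl, rfl, rfl⟩, h⟩; simp [h]
  · intro h
    exact Finset.mem_filter.2 ⟨Finset.mem_univ _, by simpa [inc, config] using h⟩

theorem cost_shadow (C D : Pos × CC) (x : Pos → Γ) :
    cost go wr (config C D x) .shadow = if D = C then -1 else 0 := by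
  refine sum_eq_ite _ _ (D.1, .copy D.2) _ ?_ ?_
  · rintro ⟨j, c | g | ⟨c, g⟩⟩ he
    · simp only [delay, two_le_load_copy]
      refine if_congr ?_ rfl rfl
      obtain ⟨d, c'⟩ := D
      simp only [Prod.mk.injEq, Res.copy.injEq]
      constructor
      · rintro ⟨h, rfl, rfl⟩; simp [h]
      · rintro ⟨⟨rfl, rfl⟩, h⟩; simp [h]
    · simp [delay]
    · simp [delay]
  · intro h
    exact Finset.mem_filter.2 ⟨Finset.mem_univ _, by simp [inc, config]⟩

/-- Cells away from the shadow are indifferent to their symbol and never move, so the rest of the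
tape is preserved. -/
theorem cost_cell (C D : Pos × CC) (x : Pos → Γ) (i : Pos) :
    cost go wr (config C D x) (.cell i) = if D.1 = i ∧ wr D (x i) then -1 else 0 := by
  refine sum_eq_ite _ _ (i, .write (x i)) _ ?_ ?_
  · rintro ⟨j, c | g | ⟨c, g⟩⟩ he
    · simp [delay]
    · simp only [delay, two_le_load_write]
      refine if_congr ?_ rfl rfl
      simp only [Prod.mk.injEq, Res.write.injEq]
      constructor
      · rintro ⟨rfl, ⟨rfl, h⟩, rfl⟩; simp [h]
      · rintro ⟨⟨rfl, rfl⟩, h⟩; simp [h]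
    · simp [delay]
  · intro h
    exact Finset.mem_filter.2 ⟨Finset.mem_univ _, by simp [inc, config]⟩

/-- The moves of the game in terms of the control, its shadow, and the cells. -/
inductive Move : (Pos × CC) × (Pos × CC) × (Pos → Γ) → (Pos × CC) × (Pos × CC) × (Pos → Γ) → Prop
  | ctrl {C D x t} (h : go D (x D.1) t) (h' : ¬ go D (x D.1) C) : Move (C, D, x) (t, D, x)
  | shadow {C D x} (h : D ≠ C) : Move (C, D, x) (C, C, x)
  | cell {C D x b} (h : wr D b) (h' : ¬ wr D (x D.1)) :
      Move (C, D, x) (C, D, Function.update x D.1 b)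

/-- Costs take only the values 0 and -1, so a move improves exactly when the mover's condition fails
before it and holds after it. -/
theorem move_iff (C D : Pos × CC) (x : Pos → Γ) (Y : (i : Player Pos) → i.Strategy Pos CC Γ) :
    (∃ i t, Y = Function.update (config C D x) i t ∧
      cost go wr Y i < cost go wr (config C D x) i) ↔
    ∃ C' D' x', Y = config C' D' x' ∧ Move go wr (C, D, x) (C', D', x') := by
  constructor
  · rintro ⟨i, t, rfl, h⟩
    cases i with
    | ctrl =>
      rw [update_ctrl] at h ⊢
      rw [cost_ctrl, cost_ctrl] at h
      refine ⟨_, _, _, rfl, .ctrl ?_ ?_⟩ <;> by_contra h' <;> simp [h'] at h <;> split_ifs at h <;>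
        omega
    | shadow =>
      rw [update_shadow] at h ⊢
      rw [cost_shadow, cost_shadow] at h
      refine ⟨_, _, _, rfl, ?_⟩
      have h1 : t = C := by
        by_contra h'
        simp [h'] at h
        split_ifs at h <;> omega
      subst h1
      refine .shadow ?_
      rintro rfl
      simp at h
    | cell i =>
      rw [update_cell] at h ⊢
      rw [cost_cell, cost_cell, Function.update_self] at h
      refine ⟨_, _, _, rfl, ?_⟩
      by_cases hi : D.1 = i
      · subst hi
        refine .cell ?_ ?_ <;> by_contra h' <;> simp [h'] at h <;> split_ifs at h <;> omega
      · simp [hi] at h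
  · rintro ⟨C', D', x', rfl, h⟩
    cases h with
    | ctrl h h' =>
      refine ⟨.ctrl, _, (update_ctrl _ _ _ _).symm, ?_⟩
      rw [cost_ctrl, cost_ctrl, if_pos h, if_neg h']
      norm_num
    | shadow h =>
      refine ⟨.shadow, _, (update_shadow _ _ _ _).symm, ?_⟩
      rw [cost_shadow, cost_shadow, if_pos rfl, if_neg h]
      norm_num
    | cell h h' =>
      refine ⟨.cell _, _, (update_cell _ _ _ _ _).symm, ?_⟩
      rw [cost_cell, cost_cell, Function.update_self, if_pos ⟨rfl, h⟩, if_neg (by simp [h'])]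
      norm_num

end ControlGame

/-! ### Runs of the game -/

namespace ControlGame

variable {Pos P Γ : Type} [DecidableEq Pos]
  (go : Pos × (P × Option Γ) → Γ → Pos × (P × Option Γ) → Bool)
  (wr : Pos × (P × Option Γ) → Γ → Bool)

/-- Strategies of the control, its shadow, and the cells. -/
abbrev Triple (Pos P Γ : Type) : Type :=
  (Pos × (P × Option Γ)) × (Pos × (P × Option Γ)) × (Pos → Γ)

/-- There is exactly one move from `S`, and it leads to `S'`. -/
def UniqueMove (S S' : Triple Pos P Γ) : Prop := ∀ T, Move go wr S T ↔ T = S'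

/-- The state of the game in which the control is in state `q` at position `h` and is about to read
a symbol. -/
def ready (q : P) (h : Pos) (x : Pos → Γ) : Triple Pos P Γ := ((h, (q, none)), (h, (q, none)), x)

/-- The control has read symbol `a`. -/
def didRead (q : P) (h : Pos) (a : Γ) (x : Pos → Γ) : Triple Pos P Γ :=
  ((h, (q, some a)), (h, (q, some a)), x)

/-- A control that is about to read a symbol reads the symbol at its position. -/
def Reads : Prop :=
  (∀ h q g t, go (h, (q, none)) g t ↔ t = (h, (q, some g))) ∧ ∀ h q g, ¬ wr (h, (q, none)) g

/-- A step of the simulated machine. -/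
def Step (q : P) (h : Pos) (x : Pos → Γ) (q' : P) (h' : Pos) (x' : Pos → Γ) : Prop :=
  ∃ b, (∀ g, wr (h, (q, some (x h))) g ↔ g = b) ∧
    (∀ g t, go (h, (q, some (x h))) g t ↔ g = b ∧ t = (h', (q', none))) ∧
    x' = Function.update x h b

/-- The simulated machine has halted. -/
def Halts (q : P) (h : Pos) (x : Pos → Γ) : Prop :=
  (∀ g, ¬ wr (h, (q, some (x h))) g) ∧ ∀ g t, ¬ go (h, (q, some (x h))) g t

variable {go wr}

theorem UniqueMove.move {S S' : Triple Pos P Γ} (h : UniqueMove go wr S S') : Move go wr S S' :=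
  (h S').2 rfl

/-- The symbol is first copied into the control and then into the shadow. This has to precede the
writing: afterwards the old symbol, on which the transition depends, survives only there. -/
theorem transGen_didRead (hr : Reads go wr) (q : P) (h : Pos) (x : Pos → Γ) :
    Relation.TransGen (UniqueMove go wr) (ready q h x) (didRead q h (x h) x) := by
  refine .head (b := ((h, (q, some (x h))), (h, (q, none)), x)) ?_ (.single ?_)
  · intro T
    constructor
    · intro hT
      cases hT with
      | ctrl h1 h2 => rw [hr.1] at h1; rw [h1]
      | shadow h1 => exact absurd rfl h1
      | cell h1 h2 => exact absurd h1 (hr.2 _ _ _)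
    · rintro rfl
      exact .ctrl ((hr.1 _ _ _ _).2 rfl) (by rw [hr.1]; simp)
  · intro T
    constructor
    · intro hT
      cases hT with
      | ctrl h1 h2 => exact absurd ((hr.1 _ _ _ _).2 rfl) h2
      | shadow h1 => rfl
      | cell h1 h2 => exact absurd h1 (hr.2 _ _ _)
    · rintro rfl
      exact .shadow (by simp)

/-- The order of moves is forced: the control has a successor only once the cell shows `b`, and
while the shadow lags behind, control and cell are already content. -/
theorem Step.transGen (hr : Reads go wr) {q : P} {h : Pos} {x : Pos → Γ} {q' : P} {h' : Pos}
    {x' : Pos → Γ} (hs : Step go wr q h x q' h' x') :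
    Relation.TransGen (UniqueMove go wr) (ready q h x) (ready q' h' x') := by
  obtain ⟨b, hw, hg, rfl⟩ := hs
  set a := x h with ha
  have hb : Function.update x h b h = b := Function.update_self _ _ _
  have h1 := transGen_didRead hr q h x
  -- If the symbol to be written is already there, no move takes place.
  have h2 : Relation.ReflTransGen (UniqueMove go wr) (didRead q h a x)
      (didRead q h a (Function.update x h b)) := by
    by_cases hab : x h = b
    · rw [← hab, Function.update_eq_self]
    · refine .single fun T => ⟨fun hT => ?_, ?_⟩
      · cases hT with
        | ctrl h1 h2 => exact absurd ((hg _ _).1 h1).1 hab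
        | shadow h1 => exact absurd rfl h1
        | cell h1 h2 => rw [(hw _).1 h1]; rfl
      · rintro rfl
        exact .cell ((hw _).2 rfl) (by rw [hw]; exact hab)
  have h3 : UniqueMove go wr (didRead q h a (Function.update x h b))
      ((h', (q', none)), (h, (q, some a)), Function.update x h b) := by
    intro T
    constructor
    · intro hT
      cases hT with
      | ctrl h1 h2 => rw [((hg _ _).1 h1).2]
      | shadow h1 => exact absurd rfl h1
      | cell h1 h2 => exact absurd ((hw _).2 hb) h2
    · rintro rfl
      exact .ctrl ((hg _ _).2 ⟨hb, rfl⟩) (by rw [hg]; simp)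
  have h4 : UniqueMove go wr ((h', (q', none)), (h, (q, some a)), Function.update x h b)
      (ready q' h' (Function.update x h b)) := by
    intro T
    constructor
    · intro hT
      cases hT with
      | ctrl h1 h2 => exact absurd ((hg _ _).2 ⟨hb, rfl⟩) h2
      | shadow h1 => rfl
      | cell h1 h2 => exact absurd ((hw _).2 hb) h2
    · rintro rfl
      exact .shadow (by simp)
  exact ((h1.trans_left h2).tail h3).tail h4

theorem Halts.not_move {q : P} {h : Pos} {x : Pos → Γ} (hh : Halts go wr q h x)
    (T : Triple Pos P Γ) : ¬ Move go wr (didRead q h (x h) x) T := by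
  intro hT
  cases hT with
  | ctrl h1 h2 => exact hh.2 _ _ h1
  | shadow h1 => exact absurd rfl h1
  | cell h1 h2 => exact hh.1 _ h1

/-- If the unique run from `S` returns to `S`, then every state that can be reached from `S` can
reach `S`. -/
theorem reflTransGen_of_cycle {S : Triple Pos P Γ}
    (hS : Relation.TransGen (UniqueMove go wr) S S) {T : Triple Pos P Γ}
    (h : Relation.ReflTransGen (Move go wr) S T) : Relation.ReflTransGen (Move go wr) T S := by
  -- The invariant is that `T` still lies on the cycle: any move from `T` is the unique one, hence
  -- the next one on the way to `S`; at `S` itself the cycle starts over.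
  suffices H : Relation.ReflTransGen (UniqueMove go wr) T S from
    Relation.ReflTransGen.mono (r := UniqueMove go wr) (fun _ _ h => h.move) _ _ H
  induction h with
  | refl => exact .refl
  | tail _ h ih =>
    rcases Relation.ReflTransGen.cases_head ih with rfl | ⟨U, hU, hUS⟩
    · obtain ⟨U, hU, hUS⟩ := Relation.TransGen.head'_iff.1 hS
      rwa [(hU _).1 h]
    · rwa [(hU _).1 h]

/-- If the unique run from a state ends, then the state cannot be reached from all states that it
reaches. -/
theorem exists_of_halts (hr : Reads go wr) {S : Triple Pos P Γ} {q : P} {h : Pos} {x : Pos → Γ}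
    (hS : Relation.ReflTransGen (UniqueMove go wr) S (ready q h x)) (hh : Halts go wr q h x) :
    ∃ T, Relation.ReflTransGen (Move go wr) S T ∧ ¬ Relation.ReflTransGen (Move go wr) T S := by
  have h1 := (Relation.TransGen.trans_right hS (transGen_didRead hr q h x))
  refine ⟨_, Relation.ReflTransGen.mono (r := UniqueMove go wr) (fun _ _ h => h.move) _ _
    h1.to_reflTransGen, fun h2 => ?_⟩
  -- The final state has no move. It differs from `S`, because reading the last symbol already
  -- ensures that the run from `S` has at least one move.
  rcases Relation.ReflTransGen.cases_head h2 with h3 | ⟨U, hU, -⟩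
  · obtain ⟨U, hU, -⟩ := Relation.TransGen.head'_iff.1 h1
    rw [← h3] at hU
    exact hh.not_move _ hU.move
  · exact hh.not_move _ hU

end ControlGame

/-! ### Simulation of Turing machines -/

/-- The relation of position `j` to position `h`. -/
def Mark.of (h j : ℕ) : Mark :=
  if j + 1 = h then .pred else if j = h then .same else if j = h + 1 then .succ else .far

namespace SingleTapeTM

variable (M : SingleTapeTM)

/-- The contents of the control: the state of the machine (or `none` while the tape is being
restored), and the symbol that has been read. -/
abbrev Control : Type := Option M.State × Option M.Symbol

/-- The symbol on the tape in the beginning. -/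
def letterSymbol (a : Letter) : M.Symbol := a.sym.elim M.blank M.input

open Classical in
/-- The symbol `g` is to be written at a position with letter `b`. -/
noncomputable def writes : M.Control → Letter → M.Symbol → Bool
  | (_, none), _, _ => false
  | (none, some _), b, g => decide (g = M.letterSymbol b)
  | (some q, some a), _, g =>
    if q = M.accept then decide (g = a)
    else if q = M.reject then false
    else decide (g = (M.transition q a).2.1)

open Classical in
/-- The control changes from the contents `c` at a position with letter `b` and symbol `g` to the
contents `c'` at a position with letter `b'`; the first position has the mark `k` relative to the
second one. -/
noncomputable def goes (c : M.Control) (b : Letter) (g : M.Symbol) (c' : M.Control) (b' : Letter)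
    (k : Mark) : Bool :=
  match c with
  | (q, none) => decide (k = .same ∧ c' = (q, some g))
  | (none, some _) => decide (g = M.letterSymbol b ∧
      if b.last then c' = (some M.start, none) ∧ b'.first else c' = (none, none) ∧ k = .pred)
  | (some q, some a) =>
    if q = M.accept then decide (g = a ∧ c' = (none, none) ∧ b'.first)
    else if q = M.reject then false
    else decide (g = (M.transition q a).2.1 ∧ c' = (some (M.transition q a).1, none) ∧
      match (M.transition q a).2.2 with
      | .left => if b.first then k = .same else k = .succ
      | .right => k = .pred)

variable (w : List Letter)

/-- The relation `goes` for the positions of a word. -/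
noncomputable def goAt (t : Fin w.length × M.Control) (g : M.Symbol)
    (t' : Fin w.length × M.Control) : Bool :=
  M.goes t.2 w[t.1] g t'.2 w[t'.1] (Mark.of t'.1 t.1)

/-- The relation `writes` for the positions of a word. -/
noncomputable def wrAt (t : Fin w.length × M.Control) (g : M.Symbol) : Bool :=
  M.writes t.2 w[t.1] g

open ControlGame

theorem mark_of_eq_same {h j : ℕ} : Mark.of h j = .same ↔ j = h := by
  unfold Mark.of; split_ifs <;> simp <;> omega

theorem mark_of_eq_pred {h j : ℕ} : Mark.of h j = .pred ↔ j + 1 = h := by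
  unfold Mark.of; split_ifs <;> simp <;> omega

theorem mark_of_eq_succ {h j : ℕ} : Mark.of h j = .succ ↔ j = h + 1 := by
  unfold Mark.of; split_ifs <;> simp <;> omega

theorem reads : Reads (M.goAt w) (M.wrAt w) := by
  constructor
  · rintro h q g ⟨h', c⟩
    simp [goAt, goes, mark_of_eq_same, Prod.ext_iff, Fin.ext_iff, eq_comm (a := (h : ℕ))]
  · intro h q g
    simp [wrAt, writes]

/-- The positions are labelled as the first or last ones correctly. -/
def _root_.List.IsLabelled (w : List Letter) : Prop :=
  ∀ j (hj : j < w.length), (w[j].first ↔ j = 0) ∧ (w[j].last ↔ j + 1 = w.length)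

variable {w}

theorem step_of_accept (hw : w.IsLabelled) (h0 : 0 < w.length) (h : Fin w.length)
    (x : Fin w.length → M.Symbol) :
    Step (M.goAt w) (M.wrAt w) (some M.accept) h x none ⟨0, h0⟩ x := by
  -- Acceptance fits the pattern of a machine step by writing back the symbol that was read.
  refine ⟨x h, ?_, ?_, (Function.update_eq_self _ _).symm⟩
  · simp [wrAt, writes]
  · rintro g ⟨h', c⟩
    have hf := (hw h' h'.2).1
    simp [goAt, goes, hf, Prod.ext_iff, Fin.ext_iff]
    tauto

theorem step_restore (hw : w.IsLabelled) (h : ℕ) (h1 : h + 1 < w.length)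
    (x : Fin w.length → M.Symbol) :
    Step (M.goAt w) (M.wrAt w) none ⟨h, by omega⟩ x none ⟨h + 1, h1⟩
      (Function.update x ⟨h, by omega⟩ (M.letterSymbol w[h])) := by
  refine ⟨_, ?_, ?_, rfl⟩
  · simp [wrAt, writes]
  · rintro g ⟨h', c⟩
    have : ¬ w[h].last := by rw [(hw h (by omega)).2]; omega
    simp [goAt, goes, this, Prod.ext_iff, Fin.ext_iff, mark_of_eq_pred, eq_comm (a := h + 1)]
    tauto

theorem step_restore_last (hw : w.IsLabelled) (h : ℕ) (h1 : h + 1 = w.length)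
    (x : Fin w.length → M.Symbol) :
    Step (M.goAt w) (M.wrAt w) none ⟨h, by omega⟩ x (some M.start) ⟨0, by omega⟩
      (Function.update x ⟨h, by omega⟩ (M.letterSymbol w[h])) := by
  refine ⟨_, ?_, ?_, rfl⟩
  · simp [wrAt, writes]
  · rintro g ⟨h', c⟩
    have : w[h].last := by rw [(hw h (by omega)).2]; omega
    have hf := (hw h' h'.2).1
    simp [goAt, goes, this, hf, Prod.ext_iff, Fin.ext_iff]
    tauto

theorem halts_of_reject (h : Fin w.length) (x : Fin w.length → M.Symbol) :
    Halts (M.goAt w) (M.wrAt w) (some M.reject) h x := by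
  have := M.accept_ne_reject.symm
  constructor
  · simp [wrAt, writes, this]
  · simp [goAt, goes, this]

/-- `M.step` halts in accepting and rejecting states, so only ordinary transitions occur here, and
the successor demanded by `goes` is the next configuration. -/
theorem step_of_mem_step (hw : w.IsLabelled) {c c' : M.Config} (hc : c' ∈ M.step c)
    (h : c.head < w.length) (h' : c'.head < w.length) :
    Step (M.goAt w) (M.wrAt w) (some c.state) ⟨c.head, h⟩ (fun i => c.tape i)
      (some c'.state) ⟨c'.head, h'⟩ (fun i => c'.tape i) := by
  unfold step at hc
  split_ifs at hc with hs
  · simp at hc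
  · push Not at hs
    simp only [Option.mem_def, Option.some.injEq] at hc
    subst hc
    refine ⟨(M.transition c.state (c.tape c.head)).2.1, ?_, ?_, ?_⟩
    · simp [wrAt, writes, hs]
    · rintro g ⟨h₁, c₁⟩
      have hf := (hw c.head h).1
      simp only [goAt, goes, hs, if_false, decide_eq_true_eq, Fin.getElem_fin, Prod.ext_iff,
        Fin.ext_iff]
      cases hd : (M.transition c.state (c.tape c.head)).2.2 with
      | left =>
        -- At the left end the truncated `c.head - 1` leaves the head in place, which `goes`
        -- expresses through the label `first`.
        by_cases h0 : c.head = 0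
        · have := hf.2 h0
          simp only [this, if_true, mark_of_eq_same, eq_comm (a := c.head)]
          simp [h0]
          tauto
        · have : w[c.head].first = false := by simpa using mt hf.1 h0
          have e : ∀ n, c.head = n + 1 ↔ n = c.head - 1 := by omega
          simp [this, mark_of_eq_succ, e]
          tauto
      | right =>
        simp [mark_of_eq_pred, eq_comm (a := c.head + 1)]
        tauto
    · funext i
      by_cases hi : i = ⟨c.head, h⟩
      · subst hi; simp
      · have : (i : ℕ) ≠ c.head := fun h' => hi (Fin.ext h')
        simp [hi, this]

/-- The state of the game that corresponds to the start configuration. -/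
def startState (w : List Letter) (h0 : 0 < w.length) :
    Triple (Fin w.length) (Option M.State) M.Symbol :=
  ready (some M.start) ⟨0, h0⟩ fun i => M.letterSymbol w[i]

/-- During the sweep the cells left of `h` already carry their initial symbols, and `n` positions
remain to the right of `h`. Each letter records its initial symbol, so the outcome does not depend
on what the computation left behind. -/
theorem transGen_restore (hw : w.IsLabelled) (n : ℕ) : ∀ (h : ℕ) (hh : h + n + 1 = w.length)
    (x : Fin w.length → M.Symbol) (_ : ∀ i : Fin w.length, (i : ℕ) < h → x i = M.letterSymbol w[i]),
    Relation.TransGen (UniqueMove (M.goAt w) (M.wrAt w)) (ready none ⟨h, by omega⟩ x)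
      (M.startState w (by omega)) := by
  induction n with
  | zero =>
    intro h hh x hx
    have h1 := (M.step_restore_last hw h hh x).transGen (M.reads w)
    have e : Function.update x ⟨h, by omega⟩ (M.letterSymbol w[h]) =
        fun i => M.letterSymbol w[i] := by
      funext i
      by_cases hi : i = ⟨h, by omega⟩
      · subst hi; simp
      · rw [Function.update_of_ne hi]
        exact hx i (by have := i.2; have : (i : ℕ) ≠ h := fun h' => hi (Fin.ext h'); omega)
    rw [e] at h1
    exact h1
  | succ n ih =>
    intro h hh x hx
    have h1 := (M.step_restore hw h (by omega) x).transGen (M.reads w)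
    refine h1.trans (ih (h + 1) (by omega) _ fun i hi => ?_)
    by_cases hi' : i = ⟨h, by omega⟩
    · rw [hi', Function.update_self]; rfl
    · rw [Function.update_of_ne hi']
      exact hx i (by have : (i : ℕ) ≠ h := fun h' => hi' (Fin.ext h'); omega)

/-- The space bound enters through `hlt`: the head never leaves the finitely many positions that are
cells of the game. -/
theorem reflTransGen_of_reaches (hw : w.IsLabelled) {c c' : M.Config}
    (hc : StateTransition.Reaches M.step c c')
    (hlt : ∀ c', StateTransition.Reaches M.step c c' → c'.head < w.length) :
    Relation.ReflTransGen (UniqueMove (M.goAt w) (M.wrAt w))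
      (ready (some c.state) ⟨c.head, hlt c .refl⟩ fun i => c.tape i)
      (ready (some c'.state) ⟨c'.head, hlt c' hc⟩ fun i => c'.tape i) := by
  induction hc with
  | refl => exact .refl
  | tail h1 h2 ih =>
    exact ih.trans ((M.step_of_mem_step hw h2 (hlt _ h1) (hlt _ (h1.tail h2))).transGen
      (M.reads w)).to_reflTransGen

/-- The simulating game returns to the start state from all states that it reaches if and only if
the machine accepts. -/
theorem reach_iff_mem {L : Language Bool} {s : ℕ → ℕ} (hM : M.DecidesInSpace L s) {x : List Bool}
    {w : List Letter} (hw : w.IsLabelled) (h0 : 0 < w.length) (hs : s x.length ≤ w.length)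
    (hx : ∀ j (hj : j < w.length), w[j].sym = x[j]?) :
    (∀ T, Relation.ReflTransGen (Move (M.goAt w) (M.wrAt w)) (M.startState w h0) T →
      Relation.ReflTransGen (Move (M.goAt w) (M.wrAt w)) T (M.startState w h0)) ↔ x ∈ L := by
  obtain ⟨hM1, hM2, hM3⟩ := hM x
  have hlt : ∀ c, StateTransition.Reaches M.step (M.init x) c → c.head < w.length :=
    fun c hc => (hM1 c hc).trans_le hs
  have hstart : ready (some (M.init x).state) ⟨(M.init x).head, hlt _ .refl⟩
      (fun i : Fin w.length => (M.init x).tape i) = M.startState w h0 := by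
    simp only [startState, letterSymbol, init, Fin.getElem_fin, hx]
  by_cases hL : x ∈ L
  · refine iff_of_true (fun T hT => ?_) hL
    refine reflTransGen_of_cycle ?_ hT
    obtain ⟨c, hc, hacc⟩ := hM2 hL
    have h1 := M.reflTransGen_of_reaches hw hc hlt
    rw [hstart, hacc] at h1
    refine Relation.TransGen.trans_right h1 (((M.step_of_accept hw h0 _ _).transGen
      (M.reads w)).trans ?_)
    -- A sweep from position 0 assumes nothing about the tape.
    exact M.transGen_restore hw (w.length - 1) 0 (by omega) _ fun i hi => absurd hi (by omega)
  · refine iff_of_false (fun h => ?_) hL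
    obtain ⟨c, hc, hrej⟩ := hM3 hL
    have h1 := M.reflTransGen_of_reaches hw hc hlt
    rw [hstart, hrej] at h1
    obtain ⟨T, hT, hT'⟩ := exists_of_halts (M.reads w) h1 (M.halts_of_reject _ _)
    exact hT' (h T hT)

end SingleTapeTM

/-! ### The instance for a word -/

noncomputable instance {Pos : Type} [Fintype Pos] : Fintype (Player Pos) :=
  Fintype.ofInjective (β := Option (Option Pos))
    (fun | .ctrl => none | .shadow => some none | .cell i => some (some i))
    (by rintro (_ | _ | i) (_ | _ | j) h <;> simp_all)

noncomputable instance {CC Γ : Type} [Fintype CC] [Fintype Γ] : Fintype (Res CC Γ) :=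
  Fintype.ofInjective (β := CC ⊕ Γ ⊕ CC × Γ)
    (fun | .copy c => .inl c | .write g => .inr (.inl g) | .goto c g => .inr (.inr (c, g)))
    (by rintro (c | g | ⟨c, g⟩) (c' | g' | ⟨c', g'⟩) h <;> simp_all)

theorem List.nodup_finRange_flatMap_map {α : Type} (n : ℕ) {l : List α} (hl : l.Nodup) :
    ((List.finRange n).flatMap fun j => l.map (Prod.mk j)).Nodup := by
  rw [List.nodup_flatMap]
  refine ⟨fun j _ => hl.map (Prod.mk_right_injective j), ?_⟩
  refine (List.nodup_finRange n).imp fun hij => ?_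
  simp only [Function.onFun, List.disjoint_left, List.mem_map]
  rintro _ ⟨a, -, rfl⟩ ⟨b, -, h⟩
  exact hij (congrArg Prod.fst h).symm

theorem List.mem_finRange_flatMap_map {α : Type} {n : ℕ} {l : List α} (hl : ∀ a, a ∈ l)
    (p : Fin n × α) : p ∈ (List.finRange n).flatMap fun j => l.map (Prod.mk j) := by
  obtain ⟨j, a⟩ := p
  simp [hl]

namespace ControlGame

variable {CC Γ : Type} [DecidableEq CC] [DecidableEq Γ] [Fintype CC] [Fintype Γ] {n : ℕ}
  (go : Fin n × CC → Γ → Fin n × CC → Bool) (wr : Fin n × CC → Γ → Bool)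
  (C D : Fin n × CC) (x : Fin n → Γ)

/-- The list of all players. -/
def players (n : ℕ) : List (Player (Fin n)) :=
  .ctrl :: .shadow :: (List.finRange n).map .cell

/-- The list of the strategies of a player. -/
noncomputable def strategies : (i : Player (Fin n)) → List (i.Strategy (Fin n) CC Γ)
  | .ctrl => (List.finRange n).flatMap fun h => Finset.univ.toList.map (Prod.mk h)
  | .shadow => (List.finRange n).flatMap fun h => Finset.univ.toList.map (Prod.mk h)
  | .cell _ => Finset.univ.toList

/-- The game with a profile. -/
noncomputable def incidenceGame : IncidenceGame where
  N := Player (Fin n)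
  E := Fin n × Res CC Γ
  T i := i.Strategy (Fin n) CC Γ
  players := players n
  nodup_players := by
    simp only [players, List.nodup_cons, List.mem_cons, List.mem_map]
    refine ⟨by simp, by simp, (List.nodup_finRange n).map fun i j h => ?_⟩
    simpa using h
  mem_players i := by cases i <;> simp [players]
  resources := (List.finRange n).flatMap fun j => Finset.univ.toList.map (Prod.mk j)
  nodup_resources := List.nodup_finRange_flatMap_map n (Finset.nodup_toList _)
  mem_resources := List.mem_finRange_flatMap_map (by simp)
  strategies := strategies
  mem_strategies i t := by
    cases i with
    | cell i => simp [strategies]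
    | _ => exact List.mem_finRange_flatMap_map (by simp) t
  inc := inc go wr
  delay := delay
  profile := config C D x

/-- The strategies of the control, its shadow, and the cells in a profile. -/
def triple (X : (i : Player (Fin n)) → i.Strategy (Fin n) CC Γ) :
    (Fin n × CC) × (Fin n × CC) × (Fin n → Γ) :=
  (X .ctrl, X .shadow, fun i => X (.cell i))

theorem incidenceGame_move_iff (X Y : (i : Player (Fin n)) → i.Strategy (Fin n) CC Γ) :
    (incidenceGame go wr C D x).Move X Y ↔ Move go wr (triple X) (triple Y) := by
  rw [eq_config X]
  refine (move_iff go wr (X .ctrl) (X .shadow) (fun i => X (.cell i)) Y).trans ?_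
  constructor
  · rintro ⟨C', D', x', rfl, h⟩
    exact h
  · intro h
    exact ⟨_, _, _, eq_config Y, h⟩

theorem isYes_iff : (incidenceGame go wr C D x).toInstance.IsYes ↔
    ∀ T, Relation.ReflTransGen (Move go wr) (C, D, x) T →
      Relation.ReflTransGen (Move go wr) T (C, D, x) := by
  have hto : ∀ X Y, Relation.ReflTransGen (incidenceGame go wr C D x).Move X Y →
      Relation.ReflTransGen (Move go wr) (triple X) (triple Y) := fun X Y h =>
    h.lift triple fun X Y h => (incidenceGame_move_iff go wr C D x X Y).1 h
  have hfrom : ∀ S T : (Fin n × CC) × (Fin n × CC) × (Fin n → Γ),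
      Relation.ReflTransGen (Move go wr) S T →
      Relation.ReflTransGen (incidenceGame go wr C D x).Move (config S.1 S.2.1 S.2.2)
        (config T.1 T.2.1 T.2.2) := fun S T h =>
    h.lift (fun S : (Fin n × CC) × (Fin n × CC) × (Fin n → Γ) => config S.1 S.2.1 S.2.2)
      fun S T h =>
      (incidenceGame_move_iff go wr C D x _ _).2 h
  rw [IncidenceGame.isYes_toInstance_iff _ (inc_injective go wr)]
  constructor
  · intro H T hT
    exact hto _ _ (H _ (hfrom _ _ hT))
  · intro H Y hY
    have := hfrom _ _ (H _ (hto _ _ hY))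
    exact (eq_config Y) ▸ this

end ControlGame

/-! ### Writing the instance -/

open InstanceSymbol InASinkInstance

theorem zipFlatMap_eq {α β : Type*} (G : ℕ → α → List β) (r : List α) : ∀ l : List α,
    zipFlatMap (fun l a _ => G l.length a) l r =
      (List.finRange r.length).flatMap fun h : Fin r.length => G (l.length + h) r[h] := by
  induction r with
  | nil => intro l; rfl
  | cons a r ih =>
    intro l
    simp only [zipFlatMap, ih, List.length_cons, List.finRange_succ, List.flatMap_cons,
      List.flatMap_map]
    simp [Nat.add_assoc, Nat.add_comm 1]

theorem Emits.forPositions {body : Letter → Prog}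
    {G : Letter → List Letter → ℕ → List InstanceSymbol}
    (h : ∀ a, Emits (AtPosition a) (body a) fun m => G a m.word m.left.length) :
    Emits (fun m => m.left = [] ∧ m.right = [] ∧ m.tmp = [] ∧ m.preMarks = [] ∧ m.marks = [])
      (forPositions body)
      fun m => (List.finRange m.word.length).flatMap
        fun h : Fin m.word.length => G m.word[h] m.word h := by
  refine (emits_forPositions h).congr fun m _ => ?_
  rw [zipFlatMap_eq (fun h a => G a m.word h)]
  simp

theorem getElem_markBack (l : List Letter) (i : ℕ) (h : i < (markBack l).length)
    (h' : i < l.length) : (markBack l)[i] = (l[i], if i = 0 then .pred else .far) := by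
  cases l with
  | nil => simp at h'
  | cons b l => cases i <;> simp [markBack]

theorem getElem_markAhead (l : List Letter) (i : ℕ) (h : i < (markAhead l).length)
    (h' : i < l.length) : (markAhead l)[i] = (l[i], if i = 0 then .succ else .far) := by
  cases l with
  | nil => simp at h'
  | cons b l => cases i <;> simp [markAhead]

/-- The current position has index `l.length`, so the marks built on the stacks agree with the
arithmetic `Mark.of` used in the game. -/
theorem marked_eq {l r w : List Letter} {a : Letter} (hw : w = l.reverse ++ a :: r) :
    marked l a r = (List.finRange w.length).map fun j : Fin w.length =>
      (w[j], Mark.of l.length j) := by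
  subst hw
  have hb : (markBack l).length = l.length := by cases l <;> simp [markBack]
  have ha : (markAhead r).length = r.length := by cases r <;> simp [markAhead]
  refine List.ext_getElem (by simp; omega) fun j h1 h2 => ?_
  have hj : j < l.length + 1 + r.length := by simpa using h1
  simp only [marked, List.getElem_append, List.getElem_reverse, List.length_reverse, hb,
    List.getElem_map, List.getElem_finRange, Fin.getElem_fin, Fin.val_cast]
  split_ifs with h3
  · rw [getElem_markBack _ _ _ (by omega)]
    simp only [Mark.of, Prod.mk.injEq, true_and]
    split_ifs <;> first | rfl | omega
  · obtain ⟨i, rfl⟩ : ∃ i, j = l.length + i := ⟨j - l.length, by omega⟩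
    cases i with
    | zero => simp [Mark.of]
    | succ i =>
      simp only [Nat.add_sub_cancel_left, List.getElem_cons_succ]
      rw [getElem_markAhead _ _ _ (by omega)]
      simp only [Mark.of, Prod.mk.injEq, true_and]
      split_ifs <;> first | rfl | omega

theorem Emits.forMarks (a : Letter) {body : Letter × Mark → Prog}
    {F : Letter × Mark → List Letter → List InstanceSymbol}
    (h : ∀ b, Emits (fun m => m.tmp = []) (body b) (fun m => F b m.word)) :
    Emits (AtPosition a) (forMarks a body)
      (fun m => (List.finRange m.word.length).flatMap fun j : Fin m.word.length =>
        F (m.word[j], Mark.of m.left.length j) m.word) := by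
  refine (emits_forMarks a h).congr fun m hm => ?_
  rw [marked_eq hm.1, List.flatMap_map]

/-- Write `f 1, …, f n` where `n` is the length of the word plus 2. -/
def writeDelays (f : ℕ → ℤ) : Prog :=
  .seq (emit (encodeInt (f 1) ++ encodeInt (f 2))) (forWord fun _ => encodeInt (f 3))

/-- The game has two players more than the word has letters. Delays are constant from congestion 3
on, so the values at 1 and 2 followed by one copy of `f 3` per letter have the right number without
any counting. -/
theorem emits_writeDelays {f : ℕ → ℤ} (hf : ∀ k, 3 ≤ k → f k = f 3) :
    Emits (fun m => m.tmp = []) (writeDelays f) fun m =>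
      (List.range (m.word.length + 2)).flatMap fun k => encodeInt (f (k + 1)) := by
  refine ((emits_emit _).seq (emits_forWord _)).congr fun m _ => ?_
  have h : ∀ k, f (k + 1 + 1 + 1) = f 3 := fun k => hf _ (by omega)
  rw [List.range_succ_eq_map, List.range_succ_eq_map]
  simp only [List.flatMap_cons, List.flatMap_map, List.map_cons, List.map_map, List.append_assoc,
    Function.comp_def, h, Nat.succ_eq_add_one]
  congr 2
  generalize m.word = w
  generalize encodeInt (f 3) = e
  induction w with
  | nil => rfl
  | cons a w ih => rw [List.length_cons, List.range_succ_eq_map]; simp [ih, List.flatMap_map]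

section

variable {CC Γ : Type} [Fintype CC] [Fintype Γ]

/-- Write the strategy that contains the resources given by `f`, at a position with letter `a`. -/
noncomputable def writeStrategy (a : Letter) (f : Letter × Mark → Res CC Γ → Bool) : Prog :=
  .seq (forMarks a fun b => emit (Finset.univ.toList.map fun d => bit (f b d))) (emit [comma])

/-- The description of the strategy that contains the resources given by `f`, at position `h`. -/
noncomputable def strategyText (f : Letter × Mark → Res CC Γ → Bool) (w : List Letter) (h : ℕ) :
    List InstanceSymbol :=
  ((List.finRange w.length).flatMap fun j : Fin w.length => Finset.univ.toList.map fun d =>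
    bit (f (w[j], Mark.of h j) d)) ++ [comma]

theorem emits_writeStrategy (a : Letter) (f : Letter × Mark → Res CC Γ → Bool) :
    Emits (AtPosition a) (writeStrategy a f) fun m => strategyText f m.word m.left.length :=
  (Emits.forMarks a (F := fun b _ => Finset.univ.toList.map fun d => bit (f b d))
    fun _ => emits_emit _).seq (emits_emit _)

end

/-- In the profile, control and shadow have one strategy each, at position 0; a loop over all
positions that writes only at the letter labelled `first` produces it. -/
theorem List.flatMap_finRange_ite {α : Type*} {n : ℕ} {P : Fin n → Bool}
    (hP : ∀ h, P h ↔ (h : ℕ) = 0) (h0 : 0 < n) (f : Fin n → List α) :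
    (List.finRange n).flatMap (fun h => if P h then f h else []) = f ⟨0, h0⟩ := by
  cases n with
  | zero => omega
  | succ n =>
    have h1 : P 0 := (hP 0).2 rfl
    have h2 : ∀ h : Fin n, P h.succ = false := fun h => by simpa using mt (hP h.succ).1
    simp [List.finRange_succ, List.flatMap_map, h1, h2]

theorem ControlGame.delay_eq {Pos CC Γ : Type} [DecidableEq Pos] (i : Player Pos)
    (e : Pos × Res CC Γ) (k : ℕ) (hk : 3 ≤ k) :
    ControlGame.delay i e k = ControlGame.delay i e 3 := by
  have : 2 ≤ k := by omega
  obtain ⟨j, d | d | d⟩ := e <;> cases i <;> simp [ControlGame.delay, hk, this]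

/-- The delays `f 1, …, f n`. -/
def delaysText (f : ℕ → ℤ) (w : List Letter) : List InstanceSymbol :=
  (List.range (w.length + 2)).flatMap fun k => encodeInt (f (k + 1))

namespace SingleTapeTM

variable (M : SingleTapeTM)

/-- The delays for a cell of the resources at a position. -/
def cellDelay (k : Mark) (d : Res M.Control M.Symbol) (n : ℕ) : ℤ :=
  if k = .same then ControlGame.delay (Player.cell ()) ((), d) n else 0

theorem delay_cell {n : ℕ} (h j : Fin n) (d : Res M.Control M.Symbol) :
    ControlGame.delay (Player.cell j) (h, d) = M.cellDelay (Mark.of h j) d := by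
  funext k
  cases d <;> simp [ControlGame.delay, cellDelay, mark_of_eq_same, Fin.ext_iff, ite_and]

variable [DecidableEq M.State] [DecidableEq M.Symbol]

/-- The resources in a strategy of the control. -/
noncomputable def ctrlInc (c : M.Control) (a : Letter) (b : Letter × Mark) :
    Res M.Control M.Symbol → Bool
  | .copy c' => decide (b.2 = .same ∧ c = c')
  | .write _ => false
  | .goto c' g => M.goes c' b.1 g c a b.2

/-- The resources in a strategy of the shadow. -/
noncomputable def shadowInc (c : M.Control) (a : Letter) (b : Letter × Mark) :
    Res M.Control M.Symbol → Bool
  | .copy c' => decide (b.2 = .same ∧ c = c')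
  | .write g => decide (b.2 = .same) && M.writes c a g
  | .goto c' _ => decide (b.2 = .same ∧ c = c')

/-- The resources in a strategy of a cell. -/
def cellInc (g : M.Symbol) (b : Letter × Mark) : Res M.Control M.Symbol → Bool
  | .copy _ => false
  | .write g' => decide (b.2 = .same ∧ g = g')
  | .goto _ g' => decide (b.2 = .same ∧ g = g')

/-- Membership depends on the positions only through the letters and the mark, a finite amount of
data, so a fixed program can decide it inside two nested loops. The resource sits at `j`, where the
control comes from, and the strategy at `h`, where it goes. -/
theorem inc_ctrl (w : List Letter) (h j : Fin w.length) (c : M.Control)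
    (d : Res M.Control M.Symbol) : ControlGame.inc (M.goAt w) (M.wrAt w) .ctrl (h, c) (j, d) =
      M.ctrlInc c w[h] (w[j], Mark.of h j) d := by
  cases d <;> simp [ControlGame.inc, ctrlInc, goAt, mark_of_eq_same, Prod.ext_iff, Fin.ext_iff,
    eq_comm (a := (h : ℕ))]

theorem inc_shadow (w : List Letter) (h j : Fin w.length) (c : M.Control)
    (d : Res M.Control M.Symbol) : ControlGame.inc (M.goAt w) (M.wrAt w) .shadow (h, c) (j, d) =
      M.shadowInc c w[h] (w[j], Mark.of h j) d := by
  cases d <;> simp [ControlGame.inc, shadowInc, wrAt, mark_of_eq_same, Prod.ext_iff, Fin.ext_iff,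
    eq_comm (a := (h : ℕ))]

theorem inc_cell (w : List Letter) (h j : Fin w.length) (g : M.Symbol)
    (d : Res M.Control M.Symbol) : ControlGame.inc (M.goAt w) (M.wrAt w) (.cell h) g (j, d) =
      M.cellInc g (w[j], Mark.of h j) d := by
  cases d <;> simp [ControlGame.inc, cellInc, mark_of_eq_same, Fin.ext_iff, eq_comm (a := (h : ℕ))]

variable [Fintype M.State] [Fintype M.Symbol]

/-- Write the instance. -/
noncomputable def writeInstance : Prog :=
  .seq (.seq (.seq (emit [tick, tick]) (forWord fun _ => [tick])) (emit [semicolon])) <|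
  .seq (.seq (forWord fun _ => List.replicate (Fintype.card (Res M.Control M.Symbol)) tick)
    (emit [semicolon])) <|
  .seq (.seq (forPositions fun a =>
    StackProg.seqs (fun c => writeStrategy a (M.ctrlInc c a)) Finset.univ.toList) (emit
      [semicolon])) <|
  .seq (.seq (forPositions fun a =>
    StackProg.seqs (fun c => writeStrategy a (M.shadowInc c a)) Finset.univ.toList) (emit
      [semicolon])) <|
  .seq (forPositions fun a => .seq
    (StackProg.seqs (fun g => writeStrategy a (M.cellInc g)) Finset.univ.toList) (emit
      [semicolon])) <|
  .seq (forPositions fun a =>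
    if a.first then writeStrategy a (M.ctrlInc (some M.start, none) a) else .skip) <|
  .seq (forPositions fun a =>
    if a.first then writeStrategy a (M.shadowInc (some M.start, none) a) else .skip) <|
  .seq (forPositions fun a => writeStrategy a (M.cellInc (M.letterSymbol a))) <|
  forPositions fun a => StackProg.seqs (fun d : Res M.Control M.Symbol =>
    .seq (writeDelays (ControlGame.delay Player.ctrl ((), d))) <|
    .seq (writeDelays (ControlGame.delay Player.shadow ((), d))) <|
    forMarks a fun b => writeDelays (M.cellDelay b.2 d)) Finset.univ.toList

/-- The instance for a word. -/
noncomputable def instanceText (w : List Letter) : List InstanceSymbol :=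
  [tick, tick] ++ w.flatMap (fun _ => [tick]) ++ [semicolon] ++
  (w.flatMap (fun _ => List.replicate (Fintype.card (Res M.Control M.Symbol)) tick) ++
    [semicolon] ++
  ((List.finRange w.length).flatMap (fun h : Fin w.length => Finset.univ.toList.flatMap fun c =>
    strategyText (M.ctrlInc c w[h]) w h) ++ [semicolon] ++
  ((List.finRange w.length).flatMap (fun h : Fin w.length => Finset.univ.toList.flatMap fun c =>
    strategyText (M.shadowInc c w[h]) w h) ++ [semicolon] ++
  ((List.finRange w.length).flatMap (fun h : Fin w.length => (Finset.univ.toList.flatMap fun g =>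
    strategyText (M.cellInc g) w h) ++ [semicolon]) ++
  ((List.finRange w.length).flatMap (fun h : Fin w.length => if w[h].first then
    strategyText (M.ctrlInc (some M.start, none) w[h]) w h else []) ++
  ((List.finRange w.length).flatMap (fun h : Fin w.length => if w[h].first then
    strategyText (M.shadowInc (some M.start, none) w[h]) w h else []) ++
  ((List.finRange w.length).flatMap (fun h : Fin w.length =>
    strategyText (M.cellInc (M.letterSymbol w[h])) w h) ++
  (List.finRange w.length).flatMap fun h : Fin w.length => Finset.univ.toList.flatMap fun d =>
    delaysText (ControlGame.delay Player.ctrl ((), d)) w ++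
    (delaysText (ControlGame.delay Player.shadow ((), d)) w ++
    (List.finRange w.length).flatMap fun j : Fin w.length =>
      delaysText (M.cellDelay (Mark.of h j) d) w))))))))

theorem emits_writeInstance :
    Emits (fun m => m.left = [] ∧ m.right = [] ∧ m.tmp = [] ∧ m.preMarks = [] ∧ m.marks = [])
      M.writeInstance fun m => M.instanceText m.word := by
  have hword : ∀ f, Emits
      (fun m => m.left = [] ∧ m.right = [] ∧ m.tmp = [] ∧ m.preMarks = [] ∧ m.marks = [])
      (forWord f) fun m => m.word.flatMap f := fun f =>
    (emits_forWord f).mono fun m hm => hm.2.2.1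
  have hdelay : ∀ (i : Player Unit) (d : Res M.Control M.Symbol), Emits (fun m => m.tmp = [])
      (writeDelays (ControlGame.delay i ((), d))) fun m =>
        delaysText (ControlGame.delay i ((), d)) m.word :=
    fun i d => emits_writeDelays (ControlGame.delay_eq i ((), d))
  have hcell : ∀ (k : Mark) (d : Res M.Control M.Symbol), Emits (fun m => m.tmp = [])
      (writeDelays (M.cellDelay k d)) fun m => delaysText (M.cellDelay k d) m.word := by
    refine fun k d => emits_writeDelays fun n hn => ?_
    unfold cellDelay
    rw [ControlGame.delay_eq _ _ n hn]
  refine .seq (.seq (.seq (emits_emit _) (hword _)) (emits_emit _)) <|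
    .seq (.seq (hword _) (emits_emit _)) <|
    .seq (.seq (Emits.forPositions (G := fun a w h => Finset.univ.toList.flatMap fun c =>
      strategyText (M.ctrlInc c a) w h) fun a => .seqs (fun c => emits_writeStrategy a _) _)
      (emits_emit _)) <|
    .seq (.seq (Emits.forPositions (G := fun a w h => Finset.univ.toList.flatMap fun c =>
      strategyText (M.shadowInc c a) w h) fun a => .seqs (fun c => emits_writeStrategy a _) _)
      (emits_emit _)) <|
    .seq (Emits.forPositions (G := fun _ w h => (Finset.univ.toList.flatMap fun g =>
      strategyText (M.cellInc g) w h) ++ [semicolon]) fun a => .seq (.seqs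
        (fun c => emits_writeStrategy a _) _)
      (emits_emit _)) <|
    .seq (Emits.forPositions (G := fun a w h => if a.first then
      strategyText (M.ctrlInc (some M.start, none) a) w h else []) fun a => ?_) <|
    .seq (Emits.forPositions (G := fun a w h => if a.first then
      strategyText (M.shadowInc (some M.start, none) a) w h else []) fun a => ?_) <|
    .seq (Emits.forPositions (G := fun a w h => strategyText (M.cellInc (M.letterSymbol a)) w h)
      fun a => emits_writeStrategy a _) <|
    Emits.forPositions (G := fun _ w h => Finset.univ.toList.flatMap fun d =>
      delaysText (ControlGame.delay Player.ctrl ((), d)) w ++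
      (delaysText (ControlGame.delay Player.shadow ((), d)) w ++
      (List.finRange w.length).flatMap fun j : Fin w.length =>
        delaysText (M.cellDelay (Mark.of h j) d) w))
    fun a => .seqs (fun d => .seq ((hdelay _ d).mono fun m hm => hm.2.1) <|
      .seq ((hdelay _ d).mono fun m hm => hm.2.1) <|
      Emits.forMarks a (F := fun b w => delaysText (M.cellDelay b.2 d) w) fun b => hcell b.2 d) _
  · cases a.first
    · exact .skip
    · exact emits_writeStrategy a _
  · cases a.first
    · exact .skip
    · exact emits_writeStrategy a _

/-- The game that simulates the machine, with the start profile. -/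
noncomputable def game (w : List Letter) (h0 : 0 < w.length) : IncidenceGame :=
  ControlGame.incidenceGame (M.goAt w) (M.wrAt w) (⟨0, h0⟩, (some M.start, none))
    (⟨0, h0⟩, (some M.start, none)) fun i => M.letterSymbol w[i]

/-- Both sides run through positions, control contents, symbols and resources in the same order, so
it remains to evaluate the unary counters and the loops over `first`, and to flatten the
concatenations. -/
theorem instanceText_eq {w : List Letter} (hw : w.IsLabelled) (h0 : 0 < w.length) :
    M.instanceText w = (M.game w h0).toInstance.encode := by
  have hp : (M.game w h0).players.length = w.length + 2 := by
    simp [game, ControlGame.incidenceGame, ControlGame.players]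
  have hr : (M.game w h0).resources.length =
      w.length * Fintype.card (Res M.Control M.Symbol) := by
    simp [game, ControlGame.incidenceGame]
  have hf : ∀ h : Fin w.length, w[h].first ↔ (h : ℕ) = 0 := fun h => (hw h h.2).1
  rw [IncidenceGame.encode_toInstance, hp, hr]
  unfold instanceText
  rw [List.flatMap_finRange_ite hf h0, List.flatMap_finRange_ite hf h0]
  have hd : ∀ (h : Fin w.length) (d : Res M.Control M.Symbol),
      ControlGame.delay Player.ctrl (h, d) = ControlGame.delay (Player.ctrl (Pos := Unit)) ((), d) ∧
      ControlGame.delay Player.shadow (h, d) =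
        ControlGame.delay (Player.shadow (Pos := Unit)) ((), d) := fun h d => by
    constructor <;> funext k <;> cases d <;> rfl
  have ht : ∀ n : ℕ, w.flatMap (fun _ => List.replicate n tick) =
      List.replicate (w.length * n) tick := fun n => by
    generalize w = w
    induction w with
    | nil => simp
    | cons a w ih =>
      rw [List.flatMap_cons, ih, List.length_cons, Nat.succ_mul, Nat.add_comm _ n,
        List.replicate_add]
  have ht' : [tick, tick] ++ w.flatMap (fun _ => [tick]) = List.replicate (w.length + 2) tick := by
    have := ht 1
    rw [List.replicate_one, mul_one] at this
    rw [this, Nat.add_comm, List.replicate_add]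
    rfl
  rw [ht, ht']
  simp only [game, ControlGame.incidenceGame, ControlGame.players, ControlGame.strategies,
    List.flatMap_cons, List.flatMap_map, List.map_flatMap, List.map_map, List.append_assoc,
    strategyText, delaysText, List.flatMap_assoc, Function.comp_def, ControlGame.config, inc_ctrl,
    inc_shadow, inc_cell, delay_cell, (hd _ _).1, (hd _ _).2]

end SingleTapeTM

/-! ### The space bound and the reduction -/

theorem Polynomial.exists_eval_le_pow (p : Polynomial ℕ) :
    ∃ c d : ℕ, 1 ≤ c ∧ ∀ k, p.eval k ≤ (k + c) ^ d := by
  induction p using Polynomial.induction_on' with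
  | add p q hp hq =>
    obtain ⟨c, d, hc, h⟩ := hp
    obtain ⟨c', d', hc', h'⟩ := hq
    refine ⟨c + c', d + d' + 1, by omega, fun k => ?_⟩
    have h1 : (k + c) ^ d ≤ (k + (c + c')) ^ (d + d') :=
      (Nat.pow_le_pow_left (by omega) _).trans (Nat.pow_le_pow_right (by omega) (by omega))
    have h2 : (k + c') ^ d' ≤ (k + (c + c')) ^ (d + d') :=
      (Nat.pow_le_pow_left (by omega) _).trans (Nat.pow_le_pow_right (by omega) (by omega))
    rw [Polynomial.eval_add, pow_succ]
    calc p.eval k + q.eval k ≤ (k + (c + c')) ^ (d + d') * 2 := by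
          linarith [h k, h' k]
      -- Both constants are at least 1, so the extra factor `k + (c + c')` absorbs the 2.
      _ ≤ _ := Nat.mul_le_mul_left _ (by omega)
  | monomial n a =>
    refine ⟨a + 1, n + 1, by omega, fun k => ?_⟩
    rw [Polynomial.eval_monomial, pow_succ, mul_comm]
    exact Nat.mul_le_mul (Nat.pow_le_pow_left (by omega) _) (by omega)

theorem isLabelled_paddedWord (x : List Bool) (n : ℕ) : (paddedWord x n).IsLabelled := by
  intro j hj
  simp [paddedWord]

theorem getElem_paddedWord_sym (x : List Bool) (n j : ℕ) (hj : j < (paddedWord x n).length) :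
    (paddedWord x n)[j].sym = x[j]? := by
  simp [paddedWord]

theorem mainTheorem5 : PSPACEHard inASinkPlayerSpecific := by
  rintro L ⟨M, p, hM⟩
  classical
  have := M.finiteState
  have := M.finiteSymbol
  have := Fintype.ofFinite M.State
  have := Fintype.ofFinite M.Symbol
  obtain ⟨c, d, hc, hp⟩ := p.exists_eval_le_pow
  refine ⟨_, M.emits_writeInstance.nonempty_tm2ComputableInPolyTime c d, fun x => ?_⟩
  have hl : (paddedWord x ((x.length + c) ^ d)).length = x.length + (x.length + c) ^ d := by
    simp [paddedWord]
  have hlab := isLabelled_paddedWord x ((x.length + c) ^ d)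
  have hsym := getElem_paddedWord_sym x ((x.length + c) ^ d)
  -- Since `1 ≤ c`, the padding is nonempty, and position 0 exists even for the empty input.
  have hpos : 0 < (x.length + c) ^ d := Nat.pow_pos (by omega)
  change _ ↔ M.instanceText (paddedWord x ((x.length + c) ^ d)) ∈ inASinkPlayerSpecific
  generalize paddedWord x ((x.length + c) ^ d) = w at *
  have h0 : 0 < w.length := by omega
  rw [M.instanceText_eq hlab h0, ← M.reach_iff_mem hM hlab h0 (by have := hp x.length; omega) hsym]
  refine (ControlGame.isYes_iff _ _ _ _ _).symm.trans ⟨fun h => ⟨_, rfl, h⟩, ?_⟩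
  rintro ⟨I, hI, h⟩
  -- The text could belong to the language through some other instance; injectivity of the encoding
  -- excludes this.
  exact InASinkInstance.encode_injective hI ▸ h
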